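/- Let $p$ be a prime, $R=\mathbb F_p[x^{\pm}]$ the ring of Laurent polynomials, $r\mapsto\bar r$ the $\mathbb F_p$-linear involution of $R$ with $\bar x=x^{-1}$, and let $M^\dagger$ denote the transpose of a matrix $M$ over $R$ followed by the entrywise involution. Let $\Xi$ be a square matrix over $R$ which is the matrix of an anti-hermitian form, $\Xi^\dagger=-\Xi$; if $p=2$, assume in addition that every diagonal entry $\Xi_{jj}$ has zero constant term (coefficient of $x^0$); for odd $p$ this is automatic. For $b\ge 1$ regard $R$ as a module over $S=\mathbb F_p[y^{\pm}]$ through $\phi^{(b)}:S\to R$, $y\mapsto x^b$, so that $R$ is free over $S$ with basis $1,x,\dots,x^{b-1}$. Let $\phi^{(b)}_\#(\Xi)$ be the matrix over $S$, with rows and columns indexed by pairs $(u,i)$ with $u$ an index of $\Xi$ and $0\le i<b$, whose entry at $((u,i),(v,j))$ is the image of $x^{-i}\,\Xi_{uv}\,x^{j}$ under the projection $R\to S$ that sends $x^{bk}$ to $y^k$ and every other power of $x$ to $0$. (Equivalently, it is the matrix of the $S$-linear map given by $\Xi$ in the basis $x^i e_u$.) Put $$\xi=\begin{pmatrix}0&y-1\\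 -y^{-1}+1&0\end{pmatrix},\qquad \lambda_1=\begin{pmatrix}0&1\\-1&0\end{pmatrix},$$ and write $A\cong B$ if $B=E^\dagger A E$ for an invertible matrix $E$ over $S$, where $\dagger$ over $S$ is defined with $\bar y=y^{-1}$. Then there are integers $b\ge 1$ and $s,t\ge 0$ such that $$\phi^{(b)}_\#(\Xi)\;\cong\;\xi^{\oplus s}\oplus\lambda_1^{\oplus t}\oplus 0,$$ where $0$ is a zero matrix of some size (possibly empty). The integer $s$ is uniquely determined by $\Xi$, irrespective of $b$: if $b,b'\ge1$ and $\phi^{(b)}_\#(\Xi)\cong\xi^{\oplus s}\oplus\lambda_1^{\oplus t}\oplus0$ and $\phi^{(b')}_\#(\Xi)\cong\xi^{\oplus s'}\oplus\lambda_1^{\oplus t'}\oplus0$, then $s=s'$. -/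

import Mathlib

open Matrix
open scoped LaurentPolynomial

noncomputable section

namespace LaurentForm

variable {F : Type*} [CommRing F] {ι κ μ : Type*}

/-- `M†`: the transpose of `M`, followed entrywise by the involution `x ↦ x⁻¹` fixing `F`. -/
def dagger (M : Matrix ι κ F[T;T⁻¹]) : Matrix κ ι F[T;T⁻¹] :=
  Mᵀ.map LaurentPolynomial.invert

/-- The matrix `Ξ` is the Gram matrix of an anti-hermitian form: `Ξ† = -Ξ`. -/
def IsAntiHermitian (Ξ : Matrix ι ι F[T;T⁻¹]) : Prop :=
  dagger Ξ = -Ξ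

/-- Every diagonal entry of `Ξ` has coefficient `0` at `x⁰`. -/
def DiagZeroConst (Ξ : Matrix ι ι F[T;T⁻¹]) : Prop :=
  ∀ i, (Ξ i i).coeff 0 = 0

/-- Two Gram matrices are congruent, i.e. they are matrices of isometric forms: `B = E† A E` for an
invertible matrix `E`. The two index types may differ; `E` has a two-sided inverse. -/
def Congruent [Fintype ι] [DecidableEq ι] [Fintype κ] [DecidableEq κ]
    (A : Matrix ι ι F[T;T⁻¹]) (B : Matrix κ κ F[T;T⁻¹]) : Prop :=
  ∃ (E : Matrix ι κ F[T;T⁻¹]) (E' : Matrix κ ι F[T;T⁻¹]),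
    E * E' = 1 ∧ E' * E = 1 ∧ dagger E * A * E = B

/-! ### Coarsening the translation group

For `b ≥ 1`, both the ring `F[x^±]` and its copy `F[y^±]`, mapped into it by `y ↦ x ^ b`, are
written `F[T;T⁻¹]`. -/

theorem mul_pos_injective (b : ℕ+) : Function.Injective (fun k : ℤ => (b : ℤ) * k) :=
  mul_right_injective₀ (by exact_mod_cast b.ne_zero)

/-- The inclusion of the coarse ring: `y ↦ x ^ b`. -/
def phi (F : Type*) [CommRing F] (b : ℕ+) : F[T;T⁻¹] →+* F[T;T⁻¹] :=
  AddMonoidAlgebra.mapDomainRingHom F (AddMonoidHom.mulLeft (b : ℤ))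

/-- The projection of `F[x^±]` onto the coarse ring `F[y^±]`, `y = x ^ b`, which forgets the
monomials whose exponent is not a multiple of `b`: the coefficient of `y ^ k` in the result is the
coefficient of `x ^ (b * k)`. -/
def proj (b : ℕ+) : F[T;T⁻¹] → F[T;T⁻¹] :=
  AddMonoidAlgebra.comapDomain (fun k : ℤ => (b : ℤ) * k) (mul_pos_injective b)

/-- The Gram matrix over the coarse ring of the form with Gram matrix `Ξ`, after restriction of
scalars along `phi F b`. The coarse basis consists of the vectors `x ^ i • e_u` with `0 ≤ i < b`,
and the form value `x⁻ⁱ Ξ_uv xʲ` of two of them is projected to the coarse ring. -/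
def coarsen (b : ℕ+) (Ξ : Matrix ι κ F[T;T⁻¹]) : Matrix (ι × Fin b) (κ × Fin b) F[T;T⁻¹] :=
  Matrix.of fun u v =>
    proj b (LaurentPolynomial.T (-(u.2 : ℤ)) * Ξ u.1 v.1 * LaurentPolynomial.T (v.2 : ℤ))

theorem coeff_phi (b : ℕ+) (f : F[T;T⁻¹]) (n : ℤ) :
    (phi F b f).coeff n = if (b : ℤ) ∣ n then f.coeff (n / b) else 0 := by
  have hb : (b : ℤ) ≠ 0 := by exact_mod_cast b.ne_zero
  have key : (phi F b f).coeff = f.coeff.mapDomain (fun k : ℤ => (b : ℤ) * k) := by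
    simp [phi, AddMonoidAlgebra.mapDomain]
  rw [key]
  split_ifs with h
  · obtain ⟨k, rfl⟩ := h
    rw [Int.mul_ediv_cancel_left _ hb]
    exact Finsupp.mapDomain_apply (mul_pos_injective b) _ _
  · refine Finsupp.mapDomain_of_notMem_range _ _ ?_
    rintro ⟨k, rfl⟩
    exact h (dvd_mul_right _ _)

theorem coeff_mul_T (f : F[T;T⁻¹]) (m n : ℤ) :
    (f * LaurentPolynomial.T m).coeff n = f.coeff (n - m) := by
  have h := AddMonoidAlgebra.coeff_mul_single_eq_coeff_mul (x := f) (r := (1 : F)) (m := m)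
    (m₁ := n) (n - m) (fun _ _ => by omega)
  rwa [mul_one] at h

theorem coeff_coarsen (b : ℕ+) (Ξ : Matrix ι κ F[T;T⁻¹]) (u : ι × Fin b) (v : κ × Fin b) (k : ℤ) :
    (coarsen b Ξ u v).coeff k = (Ξ u.1 v.1).coeff (b * k + u.2 - v.2) := by
  have h1 : (coarsen b Ξ u v).coeff k = (LaurentPolynomial.T (-(u.2 : ℤ)) * Ξ u.1 v.1 *
      LaurentPolynomial.T (v.2 : ℤ)).coeff (b * k) := by
    simp [coarsen, proj]
  rw [h1, LaurentPolynomial.T_mul, LaurentPolynomial.mul_T_assoc, coeff_mul_T]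
  congr 1
  ring

/-- `coarsen b Ξ` is also the matrix of `Ξ`, as a linear map, in the bases `x ^ i • e_u` over the
coarse ring. -/
theorem mul_T_eq_sum_coarsen (b : ℕ+) (Ξ : Matrix ι κ F[T;T⁻¹]) (u : ι) (v : κ × Fin b) :
    Ξ u v.1 * LaurentPolynomial.T (v.2 : ℤ) =
      ∑ i : Fin b, phi F b (coarsen b Ξ (u, i) v) * LaurentPolynomial.T (i : ℤ) := by
  ext n
  have hb : (0 : ℤ) < b := by exact_mod_cast b.pos
  have hlt : (n % b).toNat < (b : ℕ) := by
    have := Int.emod_lt_of_pos n hb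
    omega
  have hmod : (((n % b).toNat : ℕ) : ℤ) = n % b := Int.toNat_of_nonneg (Int.emod_nonneg n hb.ne')
  have hsum : ∀ g : Fin b → F[T;T⁻¹], (∑ i, g i).coeff n = ∑ i, (g i).coeff n := fun g => by
    simp
  rw [hsum, Finset.sum_eq_single ⟨(n % b).toNat, hlt⟩]
  · have hd : n - n % b = b * (n / b) := by have := Int.emod_add_mul_ediv n b; omega
    rw [coeff_mul_T, coeff_mul_T, coeff_phi]
    simp only [hmod, hd]
    rw [if_pos (dvd_mul_right _ _), coeff_coarsen, Int.mul_ediv_cancel_left _ hb.ne']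
    simp only [hmod]
    congr 1
    have := Int.emod_add_mul_ediv n b
    omega
  · intro i _ hi
    rw [coeff_mul_T, coeff_phi, if_neg]
    rintro ⟨k, hk⟩
    apply hi
    have hi' : ((i : ℕ) : ℤ) = n % b := by
      have : n = i + b * k := by omega
      rw [this, Int.add_mul_emod_self_left, Int.emod_eq_of_lt (by omega) (by exact_mod_cast i.2)]
    ext
    simp only
    omega
  · simp

/-! ### The normal form -/

/-- `λ₁`, the hyperbolic plane. -/
def lambdaOne (F : Type*) [CommRing F] : Matrix (Fin 2) (Fin 2) F[T;T⁻¹] :=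
  !![0, 1; -1, 0]

/-- The form `ξ`, with `T 1` the variable of the Laurent polynomial ring. -/
def xi (F : Type*) [CommRing F] : Matrix (Fin 2) (Fin 2) F[T;T⁻¹] :=
  !![0, LaurentPolynomial.T 1 - 1; -LaurentPolynomial.T (-1) + 1, 0]

/-- The orthogonal direct sum of `s` copies of `ξ`, `t` copies of `λ₁` and the zero form of
rank `z`. -/
def normalForm (F : Type*) [CommRing F] (s t z : ℕ) :
    Matrix ((Fin 2 × Fin s) ⊕ ((Fin 2 × Fin t) ⊕ Fin z))
      ((Fin 2 × Fin s) ⊕ ((Fin 2 × Fin t) ⊕ Fin z)) F[T;T⁻¹] :=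
  Matrix.fromBlocks (Matrix.blockDiagonal fun _ : Fin s => xi F) 0 0
    (Matrix.fromBlocks (Matrix.blockDiagonal fun _ : Fin t => lambdaOne F) 0 0 0)

end LaurentForm

end

/-! Existence. The radical splits off because $R$ is a PID, leaving a form $B$ with $\det B\ne0$.
Over a finite field $\det B$ divides $x^b-1$ for some $b$, so after coarsening the adjugate yields
$G$ with $GB=(y-1)\cdot 1$: the cokernel is killed by $y-1$ (`IsElementary`). Such a form is
decomposed by induction on the rank. It has an isotropic vector (`IsElementary.exists_isotropic`):
Chevalley–Warning in rank at least 3; in rank 2 the determinant is a norm; rank 1 does not occur.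
Made primitive, this vector lies in a copy of $\lambda_1$ or $\xi$ (`IsElementary.exists_plane`),
which splits off and leaves an elementary complement.

Uniqueness. Let `torsionCard` count the elements of the cokernel killed by some $x^k-1$. Congruence
preserves it, and so does coarsening, as $x^{bk}-1$ becomes $y^k-1$. On the normal form the count is
$|F|^{2s}$: each $\xi$ contributes two copies of $S/(y-1)\cong F$, while $\lambda_1$ and $0$
contribute no torsion. Hence $s$ depends on $\Xi$ alone. -/

namespace LaurentForm

/-! ### Laurent polynomials: evaluation at units, the involution, divisibility by $x^n-1$. -/

section Laurent

open LaurentPolynomial (T C invert)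

variable {F : Type*}

/-- In a localization of $F[X]$ every ideal is extended from its contraction. This makes the
submodules met below free and provides primitive vectors. -/
instance isPrincipalIdealRing_laurent [Field F] : IsPrincipalIdealRing F[T;T⁻¹] := by
  refine ⟨fun I => ?_⟩
  rw [← IsLocalization.map_under (Submonoid.powers (Polynomial.X : Polynomial F)) F[T;T⁻¹] I]
  obtain ⟨g, hg⟩ := (IsPrincipalIdealRing.principal
    (I.under (Polynomial F))).principal
  rw [hg]
  refine ⟨algebraMap _ _ g, ?_⟩
  exact (Ideal.map_span _ _).trans (by simp [Ideal.submodule_span_eq])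

/-- Evaluation of a Laurent polynomial at a unit. -/
noncomputable def evalUnit [CommRing F] (a : Fˣ) : F[T;T⁻¹] →+* F :=
  LaurentPolynomial.eval₂ (RingHom.id F) a

variable [CommRing F]

@[simp] theorem evalUnit_T (a : Fˣ) (n : ℤ) : evalUnit a (T n) = ((a ^ n : Fˣ) : F) := by
  simp [evalUnit]

@[simp] theorem evalUnit_C (a : Fˣ) (c : F) : evalUnit a (C c) = c := by
  simp [evalUnit]

theorem evalUnit_invert {a : Fˣ} (ha : a⁻¹ = a) (f : F[T;T⁻¹]) :
    evalUnit a (invert f) = evalUnit a f := by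
  induction f using LaurentPolynomial.induction_on' with
  | add p q hp hq => simp [hp, hq]
  | C_mul_T n c =>
    have h : a ^ (-n) = a ^ n := by rw [_root_.zpow_neg, ← _root_.inv_zpow, ha]
    simp only [map_mul, LaurentPolynomial.invert_C, LaurentPolynomial.invert_T, evalUnit_C,
      evalUnit_T, h]

@[simp] theorem invert_invert (f : F[T;T⁻¹]) : invert (invert f) = f :=
  LaurentPolynomial.involutive_invert f

theorem T_mul_T (m n : ℤ) : (T m * T n : F[T;T⁻¹]) = T (m + n) :=
  (LaurentPolynomial.T_add m n).symm

theorem T_sub_one_dvd (m n : ℤ) : (T m - 1 : F[T;T⁻¹]) ∣ T (m * n) - 1 := by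
  have h (k : ℕ) : (T m - 1 : F[T;T⁻¹]) ∣ T (m * k) - 1 := by
    have := sub_dvd_pow_sub_pow (T m : F[T;T⁻¹]) 1 k
    rwa [one_pow, LaurentPolynomial.T_pow, mul_comm] at this
  obtain ⟨k, rfl | rfl⟩ := n.eq_nat_or_neg
  · exact h k
  · have h2 : (T (m * -(k : ℤ)) - 1 : F[T;T⁻¹]) = -T (m * -(k : ℤ)) * (T (m * k) - 1) := by
      rw [mul_sub, neg_mul, T_mul_T]
      simp
      ring
    rw [h2]
    exact (h k).mul_left _

theorem T_one_sub_one_dvd_sub (f : F[T;T⁻¹]) : T 1 - 1 ∣ f - C (evalUnit 1 f) := by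
  induction f using LaurentPolynomial.induction_on' with
  | add p q hp hq => simpa [add_sub_add_comm] using dvd_add hp hq
  | C_mul_T n c =>
    have := (T_sub_one_dvd (F := F) 1 n).mul_left (C c)
    simpa [mul_sub] using this

theorem evalUnit_one_eq_zero_iff (f : F[T;T⁻¹]) : evalUnit 1 f = 0 ↔ T 1 - 1 ∣ f := by
  constructor
  · intro h
    simpa [h] using T_one_sub_one_dvd_sub f
  · rintro ⟨g, rfl⟩
    simp

/-- Monomial by monomial, $x^n-x^{-n}=x^{-n}(x^{2n}-1)$. The extra factor $x+1$, meaningful also in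
characteristic 2, is what excludes elementary forms of rank 1. -/
theorem T_two_sub_one_dvd_sub_invert (f : F[T;T⁻¹]) : T 2 - 1 ∣ f - invert f := by
  induction f using LaurentPolynomial.induction_on' with
  | add p q hp hq => simpa [add_sub_add_comm] using dvd_add hp hq
  | C_mul_T n c =>
    have h : (C c * T n - invert (C c * T n) : F[T;T⁻¹]) = C c * T (-n) * (T (2 * n) - 1) := by
      rw [mul_sub, mul_assoc, T_mul_T]
      rw [map_mul, LaurentPolynomial.invert_C, LaurentPolynomial.invert_T, mul_one]
      congr 3
      ring
    rw [h]
    exact (T_sub_one_dvd 2 n).mul_left _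

theorem T_one_sub_one_ne_zero [Nontrivial F] : (T 1 - 1 : F[T;T⁻¹]) ≠ 0 := by
  intro h
  have := congrArg (fun f => f.coeff 1) h
  simp [← LaurentPolynomial.T_zero] at this

theorem invert_T_one_sub_one : invert (T 1 - 1 : F[T;T⁻¹]) = -T (-1) * (T 1 - 1) := by
  rw [mul_sub, neg_mul, T_mul_T]
  simp
  ring

/-- An anti-invariant Laurent polynomial without constant term is of the form `g - ḡ`. -/
theorem exists_eq_sub_invert {f : F[T;T⁻¹]} (h : invert f = -f) (h0 : f.coeff 0 = 0) :
    ∃ g : F[T;T⁻¹], f = g - invert g := by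
  classical
  -- $g$ is the part of $f$ in positive degrees.
  refine ⟨.ofCoeff (f.coeff.filter (0 < ·)), ?_⟩
  ext n
  have hn : f.coeff (-n) = -f.coeff n := by
    have := congrArg (fun f => f.coeff n) h
    simpa using this
  rcases lt_trichotomy n 0 with hlt | rfl | hlt
  · simp [hlt, hlt.not_gt, hn]
  · simp [h0]
  · simp [hlt, hlt.not_gt]

end Laurent

/-! ### Units, the prime $x-1$, and divisors of $x^b-1$ over a finite field. -/

section Field

open LaurentPolynomial (T C invert)

variable {F : Type*} [Field F]

theorem prime_T_one_sub_one : Prime (T 1 - 1 : F[T;T⁻¹]) := by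
  refine ⟨T_one_sub_one_ne_zero, fun h => ?_, fun a b h => ?_⟩
  · have := h.map (evalUnit (1 : Fˣ))
    simp at this
  · simpa [← evalUnit_one_eq_zero_iff] using h

/-- After clearing denominators, $u$ becomes a divisor of a power of the prime $X$ in $F[X]$. -/
theorem exists_eq_C_mul_T_of_isUnit {u : F[T;T⁻¹]} (hu : IsUnit u) :
    ∃ (c : F) (n : ℤ), c ≠ 0 ∧ u = C c * T n := by
  obtain ⟨v, huv⟩ := hu.exists_right_inv
  obtain ⟨m, f, hf⟩ := LaurentPolynomial.exists_T_pow u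
  obtain ⟨n, g, hg⟩ := LaurentPolynomial.exists_T_pow v
  have hfg : f * g = Polynomial.X ^ (m + n) := by
    apply Polynomial.toLaurent_injective
    rw [map_mul, hf, hg, Polynomial.toLaurent_X_pow]
    calc u * T m * (v * T n) = (u * v) * (T m * T n) := by ring
      _ = _ := by rw [huv, T_mul_T]; simp
  obtain ⟨i, -, hi⟩ := (dvd_prime_pow Polynomial.prime_X _).1 ⟨g, hfg.symm⟩
  obtain ⟨w, hw⟩ := hi.symm
  obtain ⟨c, hc, hcw⟩ := Polynomial.isUnit_iff.1 w.isUnit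
  refine ⟨c, i - m, hc.ne_zero, ?_⟩
  have h2 : u = Polynomial.toLaurent f * T (-m) := by
    rw [hf, LaurentPolynomial.mul_T_assoc]
    simp
  rw [h2, ← hw, ← hcw, map_mul, Polynomial.toLaurent_X_pow, Polynomial.toLaurent_C, mul_comm (T _),
    LaurentPolynomial.mul_T_assoc, sub_eq_add_neg]

/-- The quotient of $F[X]$ by a polynomial associate of $f$ is finite, so two powers of $X$ agree in
it; their difference is a unit times $x^b-1$. This is where the coarsening factor comes from. -/
theorem exists_dvd_T_sub_one [Finite F] {f : F[T;T⁻¹]} (hf : f ≠ 0) :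
    ∃ b : ℕ+, f ∣ T (b : ℤ) - 1 := by
  obtain ⟨n, g, hg⟩ := LaurentPolynomial.exists_T_pow f
  have hg0 : g ≠ 0 := by
    rintro rfl
    rw [map_zero] at hg
    exact hf ((LaurentPolynomial.isUnit_T (R := F) n).mul_left_eq_zero.1 hg.symm)
  have : Module.Finite F (AdjoinRoot g) := (AdjoinRoot.powerBasis hg0).finite
  have : Finite (AdjoinRoot g) := Module.finite_of_finite F
  have hdvd : ∀ i j : ℕ, i < j → AdjoinRoot.mk g (Polynomial.X ^ i) =
      AdjoinRoot.mk g (Polynomial.X ^ j) → ∃ b : ℕ+, f ∣ T (b : ℤ) - 1 := by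
    intro i j hij h
    have h1 : g ∣ Polynomial.X ^ j - Polynomial.X ^ i := AdjoinRoot.mk_eq_mk.1 h.symm
    have h2 := map_dvd (Polynomial.toLaurent (R := F)) h1
    rw [hg, map_sub, Polynomial.toLaurent_X_pow, Polynomial.toLaurent_X_pow] at h2
    refine ⟨⟨j - i, by omega⟩, ?_⟩
    have h3 : (T ((j - i : ℕ) : ℤ) - 1 : F[T;T⁻¹]) = (T j - T i) * T (-i) := by
      rw [sub_mul, T_mul_T, T_mul_T]
      simp [Nat.cast_sub hij.le, sub_eq_add_neg]
    exact (dvd_of_mul_right_dvd h2).trans (h3 ▸ dvd_mul_right _ _)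
  obtain ⟨i, j, hij, h⟩ :=
    Finite.exists_ne_map_eq_of_infinite (fun i : ℕ => AdjoinRoot.mk g (Polynomial.X ^ i))
  rcases hij.lt_or_gt with hlt | hlt
  · exact hdvd i j hlt h
  · exact hdvd j i hlt h.symm

end Field

end LaurentForm

namespace LaurentForm

/-! ### Sesquilinear forms and the splitting of planes. -/

section Forms

open LaurentPolynomial (T C invert)
open Module

/-- The involution of the ring of Laurent polynomials as a ring homomorphism. -/
noncomputable def bar (F : Type*) [CommRing F] : F[T;T⁻¹] →+* F[T;T⁻¹] :=
  RingHomClass.toRingHom (invert : F[T;T⁻¹] ≃ₐ[F] F[T;T⁻¹])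

theorem bar_apply {F : Type*} [CommRing F] (f : F[T;T⁻¹]) : bar F f = invert f := rfl

/-- Forms on a module over the Laurent polynomials that are conjugate-linear in the first
variable and linear in the second one. -/
abbrev SesqForm (F M : Type*) [CommRing F] [AddCommGroup M] [Module F[T;T⁻¹] M] :=
  M →ₛₗ[bar F] M →ₗ[F[T;T⁻¹]] F[T;T⁻¹]

variable {F M : Type*} [Field F] [AddCommGroup M] [Module F[T;T⁻¹] M]

/-- Anti-hermitian forms whose values `h v v` have no constant term. -/
structure IsAlt (h : SesqForm F M) : Prop where
  anti : ∀ v w, invert (h v w) = -h w v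
  coeff_zero : ∀ v, (h v v).coeff 0 = 0

/-- The cokernel of the map `M → Hom(M, F[T;T⁻¹])` given by the form is killed by `T - 1`. -/
noncomputable def IsElementary (h : SesqForm F M) : Prop :=
  ∀ φ : M →ₗ[F[T;T⁻¹]] F[T;T⁻¹], ∃ u, ∀ w, h u w = (T 1 - 1) * φ w

theorem IsAlt.exists_apply_self {h : SesqForm F M} (hh : IsAlt h) (v : M) :
    ∃ g, h v v = g - invert g :=
  exists_eq_sub_invert (hh.anti v v) (hh.coeff_zero v)

theorem IsAlt.swap {h : SesqForm F M} (hh : IsAlt h) (v w : M) : h w v = -invert (h v w) := by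
  rw [hh.anti, neg_neg]

theorem IsAlt.restrict {h : SesqForm F M} (hh : IsAlt h) (N : Submodule F[T;T⁻¹] M) :
    IsAlt (h.domRestrict₁₂ N N) :=
  ⟨fun v w => hh.anti v w, fun v => hh.coeff_zero v⟩

/-- A nonzero vector is a multiple of a vector on which some linear functional takes the
value `1`. -/
theorem exists_smul_eq_of_ne_zero {R M : Type*} [CommRing R] [IsDomain R] [IsPrincipalIdealRing R]
    [AddCommGroup M] [Module R M] [Module.Free R M] [Module.Finite R M] {v : M} (hv : v ≠ 0) :
    ∃ (c : R) (v' : M) (φ : M →ₗ[R] R), c ≠ 0 ∧ v = c • v' ∧ φ v' = 1 := by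
  classical
  let b := Module.Free.chooseBasis R M
  -- $c$ is the gcd of the coordinates; its Bézout coefficients define $\varphi$.
  obtain ⟨c, hc⟩ := (IsPrincipalIdealRing.principal
    (Ideal.span (Set.range fun i => b.repr v i))).principal
  have hmem : ∀ i, ∃ a, b.repr v i = c * a := by
    intro i
    have h1 : b.repr v i ∈ Ideal.span (Set.range fun i => b.repr v i) :=
      Ideal.subset_span ⟨i, rfl⟩
    rw [hc] at h1
    obtain ⟨a, ha⟩ := Submodule.mem_span_singleton.1 h1
    exact ⟨a, by rw [← ha, smul_eq_mul, mul_comm]⟩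
  choose a ha using hmem
  have hcm : c ∈ Ideal.span (Set.range fun i => b.repr v i) := by
    rw [hc]
    exact Submodule.mem_span_singleton_self c
  obtain ⟨r, hr⟩ := Ideal.mem_span_range_iff_exists_fun.1 hcm
  have hva : v = c • ∑ i, a i • b i := by
    rw [Finset.smul_sum]
    conv_lhs => rw [← b.sum_repr v]
    exact Finset.sum_congr rfl fun i _ => by rw [ha, mul_smul]
  have hc0 : c ≠ 0 := by
    rintro rfl
    exact hv (by rw [hva, zero_smul])
  refine ⟨c, _, ∑ i, r i • b.coord i, hc0, hva, ?_⟩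
  apply mul_left_cancel₀ hc0
  rw [mul_one]
  conv_rhs => rw [← hr]
  simp [Finset.mul_sum, LinearMap.sum_apply, Finsupp.single_apply, ha]
  exact Finset.sum_congr rfl fun i _ => by ring

/-- The Gram matrix of a pair of isotropic vectors with product `d`. -/
noncomputable def planeGram (d : F[T;T⁻¹]) : Matrix (Fin 2) (Fin 2) F[T;T⁻¹] :=
  !![0, d; -invert d, 0]

theorem planeGram_one : planeGram (1 : F[T;T⁻¹]) = lambdaOne F := by
  simp [planeGram, lambdaOne]

theorem planeGram_T_one_sub_one : planeGram (T 1 - 1 : F[T;T⁻¹]) = xi F := by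
  simp [planeGram, xi]
  ring

/-- The vectors orthogonal to `v` and `w`. -/
noncomputable def orthPair (h : SesqForm F M) (v w : M) : Submodule F[T;T⁻¹] M :=
  LinearMap.ker (h v) ⊓ LinearMap.ker (h w)

/-- Splitting off the plane spanned by two isotropic vectors. -/
theorem IsAlt.exists_splitting {h : SesqForm F M} (hh : IsAlt h) {v w : M} {d : F[T;T⁻¹]}
    (hd : d ≠ 0) (hv : h v v = 0) (hw : h w w = 0) (hvw : h v w = d) (dv : ∀ z, d ∣ h v z)
    (dw : ∀ z, invert d ∣ h w z) :
    ∃ e : ((Fin 2 → F[T;T⁻¹]) × orthPair h v w) ≃ₗ[F[T;T⁻¹]] M,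
      ∀ c n, e (c, n) = c 0 • v + c 1 • w + n := by
  have hd' : invert d ≠ 0 := by simpa using hd
  have hwv : h w v = -invert d := by rw [hh.swap v w, hvw]
  let f : ((Fin 2 → F[T;T⁻¹]) × orthPair h v w) →ₗ[F[T;T⁻¹]] M :=
    (Fintype.linearCombination F[T;T⁻¹] ![v, w]).coprod (orthPair h v w).subtype
  have hf : ∀ c n, f (c, n) = c 0 • v + c 1 • w + n := by
    intro c n
    simp [f, Fintype.linearCombination_apply]
  refine ⟨LinearEquiv.ofBijective f ⟨?_, ?_⟩, hf⟩
  · rw [← LinearMap.ker_eq_bot, LinearMap.ker_eq_bot']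
    rintro ⟨c, n, hn⟩ hcn
    rw [hf] at hcn
    simp only at hcn
    have h1 := congrArg (h v) hcn
    have h2 := congrArg (h w) hcn
    have hn1 : h v n = 0 := hn.1
    have hn2 : h w n = 0 := hn.2
    simp only [map_add, map_smul, hv, hvw, hwv, hw, hn1, hn2, smul_eq_mul, mul_zero, zero_add,
      add_zero, map_zero, mul_neg, neg_eq_zero] at h1 h2
    have h1' := (mul_eq_zero.1 h1).resolve_right hd
    have h2' := (mul_eq_zero.1 h2).resolve_right hd'
    have hc : c = 0 := by
      ext1 i
      fin_cases i
      · exact h2'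
      · exact h1'
    subst hc
    simpa using hcn
  · intro z
    -- Divisibility by $d$ and $\bar d$ makes the orthogonal projection onto the plane integral even
    -- when $d$ is not a unit.
    obtain ⟨β, hβ⟩ := dv z
    obtain ⟨α, hα⟩ := dw z
    refine ⟨(![-α, β], ⟨z - (-α • v + β • w), ?_, ?_⟩), ?_⟩
    · simp [hv, hvw, hβ, mul_comm]
    · simp [hw, hwv, hα, mul_comm]
    · rw [hf]
      simp

/-- Extend a functional by zero on the plane and represent it on $M$; the plane component of the
representing vector pairs trivially with the complement and can be dropped. -/
theorem IsElementary.restrict_orthPair {h : SesqForm F M} (he : IsElementary h) {v w : M}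
    (e : ((Fin 2 → F[T;T⁻¹]) × orthPair h v w) ≃ₗ[F[T;T⁻¹]] M)
    (hs : ∀ c n, e (c, n) = c 0 • v + c 1 • w + n) :
    IsElementary (h.domRestrict₁₂ (orthPair h v w) (orthPair h v w)) := by
  intro φ
  obtain ⟨u, hu⟩ := he (φ ∘ₗ LinearMap.snd _ _ _ ∘ₗ e.symm.toLinearMap)
  obtain ⟨⟨c, n⟩, rfl⟩ := e.surjective u
  refine ⟨n, fun z => ?_⟩
  have h1 := hu z
  have h2 : e.symm (z : M) = (0, z) := by
    rw [LinearEquiv.symm_apply_eq, hs]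
    simp
  have hz1 : h v z = 0 := z.2.1
  have hz2 : h w z = 0 := z.2.2
  rw [LinearMap.domRestrict₁₂_apply]
  simpa [h2, hs, hz1, hz2] using h1

/-- A vector on which a functional takes the value `1` has a dual vector up to `T - 1`. -/
theorem IsElementary.exists_dual {h : SesqForm F M} (hh : IsAlt h) (he : IsElementary h) {v : M}
    {φ : M →ₗ[F[T;T⁻¹]] F[T;T⁻¹]} (hφ : φ v = 1) :
    ∃ w, h v w = T 1 - 1 ∧ ∀ z, T 1 - 1 ∣ h w z := by
  obtain ⟨u, hu⟩ := he φ
  -- The factor `T 1` compensates the unit in $-\overline{(x-1)}=x^{-1}(x-1)$.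
  refine ⟨(T 1 : F[T;T⁻¹]) • u, ?_, fun z => ?_⟩
  · rw [map_smul, hh.swap u v, hu, hφ, mul_one, invert_T_one_sub_one, smul_eq_mul, neg_mul, neg_neg,
      ← mul_assoc, T_mul_T]
    simp
  · rw [LinearMap.map_smulₛₗ₂, hu]
    exact ⟨_, by rw [smul_eq_mul, mul_left_comm]⟩

/-- A primitive isotropic vector spans a copy of `λ₁` or of `ξ` together with another isotropic
vector, and that plane can be split off. -/
theorem IsElementary.exists_plane {h : SesqForm F M} (hh : IsAlt h) (he : IsElementary h) {v : M}
    (hv : h v v = 0) {φ : M →ₗ[F[T;T⁻¹]] F[T;T⁻¹]} (hφ : φ v = 1) :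
    ∃ (w : M) (d : F[T;T⁻¹]), (d = 1 ∨ d = T 1 - 1) ∧ h w w = 0 ∧ h v w = d ∧
      (∀ z, d ∣ h v z) ∧ ∀ z, invert d ∣ h w z := by
  obtain ⟨w, hvw, hw⟩ := he.exists_dual hh hφ
  have hadd : ∀ (w : M) (c : F[T;T⁻¹]), h (w + c • v) (w + c • v) =
      h w w + (invert c * h v w - invert (invert c * h v w)) := by
    intro w c
    rw [map_add h, map_smulₛₗ h]
    simp [hv, hh.swap v w, bar_apply]
    ring
  -- The two cases yield $\xi$ and $\lambda_1$ respectively.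
  by_cases hdiv : ∀ z, T 1 - 1 ∣ h v z
  · obtain ⟨g, hg⟩ := hh.exists_apply_self w
    obtain ⟨r, hr⟩ := T_one_sub_one_dvd_sub g
    -- Adding multiples of $v$ to $w$ changes $g$ in $h(w,w)=g-\bar g$ only by multiples of $x-1$.
    -- This suffices, since the remaining constant cancels in $g-\bar g$.
    refine ⟨w - invert r • v, T 1 - 1, Or.inr rfl, ?_, ?_, hdiv, fun z => ?_⟩
    · rw [sub_eq_add_neg, ← neg_smul, hadd, hvw, hg]
      have h1 : invert (-invert r) * (T 1 - 1) = -(g - C (evalUnit 1 g)) := by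
        rw [hr, map_neg, invert_invert]
        ring
      rw [h1]
      simp
    · simp [hv, hvw]
    · have h1 : invert (T 1 - 1 : F[T;T⁻¹]) ∣ T 1 - 1 := by
        rw [invert_T_one_sub_one]
        exact ⟨-T 1, by rw [mul_right_comm, neg_mul_neg, T_mul_T]; simp⟩
      refine h1.trans ?_
      rw [map_sub, LinearMap.sub_apply, LinearMap.map_smulₛₗ₂]
      exact dvd_sub (hw z) ((hdiv z).mul_left _)
  · push Not at hdiv
    obtain ⟨z, hz⟩ := hdiv
    rw [← evalUnit_one_eq_zero_iff] at hz
    obtain ⟨r, hr⟩ := T_one_sub_one_dvd_sub (h v z)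
    set c := evalUnit 1 (h v z)
    obtain ⟨w₁, hw₁⟩ : ∃ w₁, h v w₁ = 1 := by
      -- $h(v,z)$ is a nonzero constant modulo $x-1$, and $w$ realizes $x-1$, so the constant itself
      -- is attained.
      refine ⟨C c⁻¹ • (z - r • w), ?_⟩
      have h1 : h v z = C c + (T 1 - 1) * r := by rw [← hr]; ring
      rw [map_smul, map_sub, map_smul, h1, hvw, smul_eq_mul, smul_eq_mul, mul_comm r,
        add_sub_cancel_right, ← map_mul, inv_mul_cancel₀ hz, map_one]
    obtain ⟨g, hg⟩ := hh.exists_apply_self w₁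
    refine ⟨w₁ - invert g • v, 1, Or.inl rfl, ?_, ?_, fun z => one_dvd _, fun z => by simp⟩
    · rw [sub_eq_add_neg, ← neg_smul, hadd, hw₁, hg]
      simp
    · simp [hv, hw₁]

end Forms

end LaurentForm

namespace LaurentForm

/-! ### Existence of isotropic vectors. -/

section Isotropic

open LaurentPolynomial (T C invert)
open Module

variable {F M : Type*} [Field F] [AddCommGroup M] [Module F[T;T⁻¹] M]

/-- In rank at least `3` there are isotropic vectors, by the Chevalley–Warning theorem. -/
theorem IsAlt.exists_isotropic_of_three_le [Finite F] {κ : Type*} [Fintype κ]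
    {h : SesqForm F M} (hh : IsAlt h) (b : Basis κ F[T;T⁻¹] M) (hκ : 3 ≤ Fintype.card κ) :
    ∃ v ≠ 0, h v v = 0 := by
  classical
  have := Fintype.ofFinite F
  obtain ⟨c, hc⟩ : ∃ c : ℕ, ∀ i j, ∀ m : ℤ, c ≤ m → (h (b i) (b j)).coeff m = 0 := by
    let s : Finset ℤ := Finset.univ.biUnion fun ij : κ × κ => (h (b ij.1) (b ij.2)).coeff.support
    obtain ⟨B, hB⟩ := s.bddAbove
    refine ⟨B.toNat + 1, fun i j m hm => ?_⟩
    by_contra hne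
    have : m ∈ s := Finset.mem_biUnion.2 ⟨(i, j), Finset.mem_univ _, Finsupp.mem_support_iff.2 hne⟩
    have := hB this
    omega
  let N : ℕ := 2 * c + 1
  let σ : Type _ := κ × Fin N
  let vec : (σ → F) → M := fun x => ∑ a : σ, (C (x a) * T (a.2 : ℤ)) • b a.1
  let q : ℕ → MvPolynomial σ F := fun k => ∑ a : σ, ∑ a' : σ,
    MvPolynomial.C ((h (b a.1) (b a'.1)).coeff (k + a.2 - a'.2)) *
      (MvPolynomial.X a * MvPolynomial.X a')
  have hq : ∀ k x, MvPolynomial.eval x (q k) = (h (vec x) (vec x)).coeff k := by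
    intro k x
    simp only [q, vec, map_sum, LinearMap.sum_apply, LinearMap.map_smulₛₗ₂, map_smul, smul_eq_mul,
      AddMonoidAlgebra.coeff_sum, Finsupp.finsetSum_apply, map_mul, MvPolynomial.eval_C,
      MvPolynomial.eval_X, bar_apply, LaurentPolynomial.invert_C, LaurentPolynomial.invert_T,
      Finset.mul_sum]
    rw [Finset.sum_comm]
    refine Finset.sum_congr rfl fun a _ => Finset.sum_congr rfl fun a' _ => ?_
    have h1 : ∀ f : F[T;T⁻¹], C (x a) * T (a.2 : ℤ) * (C (x a') * T (-(a'.2 : ℤ)) * f) =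
        (x a * x a') • (f * T (a.2 - a'.2 : ℤ)) := by
      intro f
      rw [LaurentPolynomial.smul_eq_C_mul, map_mul, LaurentPolynomial.T_sub]
      ring
    rw [h1, AddMonoidAlgebra.coeff_smul, Finsupp.smul_apply, coeff_mul_T, smul_eq_mul,
      show (k : ℤ) - (a.2 - a'.2) = k + a'.2 - a.2 by ring]
    ring
  have hdeg : ∀ k, (q k).totalDegree ≤ 2 := by
    intro k
    refine MvPolynomial.totalDegree_finsetSum_le fun a _ =>
      MvPolynomial.totalDegree_finsetSum_le fun a' _ => ?_
    refine (MvPolynomial.totalDegree_mul _ _).trans ?_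
    rw [MvPolynomial.totalDegree_C, zero_add]
    refine (MvPolynomial.totalDegree_mul _ _).trans ?_
    simp
  obtain ⟨p, hp⟩ := CharP.exists F
  have hpp : p.Prime := CharP.char_is_prime F p
  have hcw := char_dvd_card_solutions_of_sum_lt p (K := F) (σ := σ) (s := Finset.Ico 1 (N + c))
    (f := q) (by
      refine (Finset.sum_le_sum fun k _ => hdeg k).trans_lt ?_
      simp only [Finset.sum_const, Nat.card_Ico, smul_eq_mul, σ, Fintype.card_prod,
        Fintype.card_fin]
      have : 3 * N ≤ Fintype.card κ * N := Nat.mul_le_mul_right _ hκ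
      omega)
  have h0 : ∀ k ∈ Finset.Ico 1 (N + c), MvPolynomial.eval (0 : σ → F) (q k) = 0 := by
    intro k _
    rw [hq]
    simp [vec]
  -- The number of solutions is divisible by $p$ and positive because of the zero solution, hence
  -- there is another one.
  obtain ⟨⟨x, hx⟩, hx0⟩ := Fintype.exists_ne_of_one_lt_card
    (hpp.one_lt.trans_le (Nat.le_of_dvd (Fintype.card_pos_iff.2 ⟨⟨0, h0⟩⟩) hcw)) ⟨0, h0⟩
  replace hx0 : x ≠ 0 := fun h => hx0 (Subtype.ext h)
  have hpos : ∀ k : ℕ, 1 ≤ k → (h (vec x) (vec x)).coeff k = 0 := by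
    intro k hk
    by_cases hk2 : k < N + c
    · rw [← hq]
      exact hx k (Finset.mem_Ico.2 ⟨hk, hk2⟩)
    · rw [← hq]
      simp only [q, map_sum]
      refine Finset.sum_eq_zero fun a _ => Finset.sum_eq_zero fun a' _ => ?_
      have := a'.2.2
      rw [hc _ _ _ (by omega)]
      simp
  refine ⟨vec x, fun hv => hx0 ?_, ?_⟩
  · ext ⟨i, r⟩
    have h1 : b.repr (vec x) i = ∑ r : Fin N, C (x (i, r)) * T (r : ℤ) := by
      simp only [vec, map_sum, map_smul, Basis.repr_self, Finsupp.coe_finsetSum, Finset.sum_apply,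
        Finsupp.smul_apply, σ, Fintype.sum_prod_type, Finsupp.single_apply, smul_eq_mul]
      rw [Finset.sum_eq_single i] <;> simp +contextual
    rw [hv, map_zero] at h1
    have h2 := congrArg (fun f => f.coeff (r : ℤ)) h1
    simp only [Finsupp.zero_apply, AddMonoidAlgebra.coeff_zero, AddMonoidAlgebra.coeff_sum,
      Finsupp.finsetSum_apply, coeff_mul_T, LaurentPolynomial.C_apply] at h2
    rw [Finset.sum_eq_single r] at h2
    · simpa using h2.symm
    · intro r' _ hr'
      rw [if_neg]
      intro h3
      exact hr' (Fin.ext (by omega))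
    · simp
  · have hanti : ∀ m : ℤ, (h (vec x) (vec x)).coeff (-m) = -(h (vec x) (vec x)).coeff m := by
      intro m
      have := congrArg (fun f => f.coeff m) (hh.anti (vec x) (vec x))
      simpa using this
    ext m
    rw [AddMonoidAlgebra.coeff_zero, Finsupp.zero_apply]
    obtain ⟨k, rfl | rfl⟩ := m.eq_nat_or_neg
    · rcases k.eq_zero_or_pos with rfl | hk
      · exact hh.coeff_zero _
      · exact hpos k hk
    · rcases k.eq_zero_or_pos with rfl | hk
      · exact hh.coeff_zero _
      · rw [hanti, hpos k hk, neg_zero]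

/-- There are no elementary forms of rank `1`. -/
theorem IsElementary.false_of_rank_one {κ : Type*} [Unique κ] {h : SesqForm F M} (hh : IsAlt h)
    (he : IsElementary h) (b : Basis κ F[T;T⁻¹] M) : False := by
  obtain ⟨u, hu⟩ := he (b.coord default)
  have h1 := hu (b default)
  have h2 : u = b.coord default u • b default := by
    conv_lhs => rw [← b.sum_repr u]
    simp
  rw [h2, LinearMap.map_smulₛₗ₂] at h1
  obtain ⟨g, hg⟩ := hh.exists_apply_self (b default)
  obtain ⟨r, hr⟩ := T_two_sub_one_dvd_sub_invert g
  rw [hg, hr] at h1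
  simp only [Basis.coord_apply, Basis.repr_self, Finsupp.single_eq_same, mul_one, smul_eq_mul] at h1
  have h3 : (T 2 - 1 : F[T;T⁻¹]) = (T 1 - 1) * (T 1 + 1) := by
    have : (T 2 : F[T;T⁻¹]) = T 1 * T 1 := by rw [T_mul_T]; norm_num
    rw [this]
    ring
  rw [h3] at h1
  have h4 : (T 1 - 1 : F[T;T⁻¹]) *
      ((T 1 + 1) * (bar F (b.repr u default) * r)) = (T 1 - 1) * 1 := by
    rw [mul_one]
    conv_rhs => rw [← h1]
    ring
  -- At $-1$ the factor $x+1$ vanishes, which gives $0=1$.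
  have h5 := congrArg (evalUnit (-1)) (mul_left_cancel₀ T_one_sub_one_ne_zero h4)
  simp at h5

theorem isSquare_neg_of_four_mul [Finite F] {c d : F} (h : 4 * c = d ^ 2) : IsSquare c := by
  by_cases h2 : (2 : F) = 0
  · have : CharP F 2 := CharTwo.of_one_ne_zero_of_two_eq_zero one_ne_zero h2
    exact FiniteField.isSquare_of_char_two (ringChar.eq F 2) c
  · refine ⟨d / 2, ?_⟩
    field_simp
    linear_combination h

/-- An invariant divisor of `(T - 1) ^ 2` whose value at `-1` is a square is a norm. -/
theorem exists_eq_mul_invert [Finite F] {D : F[T;T⁻¹]} (hD : invert D = D)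
    (hdvd : D ∣ (T 1 - 1) ^ 2) {d : F} (hd : evalUnit (-1) D = d ^ 2) :
    ∃ δ, D = δ * invert δ := by
  -- $D=c\,x^n(x-1)^m$ with $m\le2$, and invariance forces $2n=-m$. For $m=0$, $D=c=d^2$. For $m=2$,
  -- $D=-c\,(x-1)\overline{(x-1)}$, and the value at $-1$ gives $-4c=d^2$.
  obtain ⟨m, hm, hDm⟩ := (dvd_prime_pow prime_T_one_sub_one _).1 hdvd
  obtain ⟨u, hu⟩ := hDm.symm
  obtain ⟨c, n, hc, hcn⟩ := exists_eq_C_mul_T_of_isUnit u.isUnit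
  rw [hcn] at hu
  have hn : T n * C c = T (-n - m) * C ((-1) ^ m * c) := by
    have h1 := hD
    rw [← hu, map_mul, map_pow, invert_T_one_sub_one, mul_pow, mul_comm _ ((T 1 - 1) ^ m),
      mul_assoc] at h1
    have h2 := mul_left_cancel₀ (pow_ne_zero _ T_one_sub_one_ne_zero) h1
    rw [mul_comm, ← h2, neg_pow, LaurentPolynomial.T_pow, map_mul, map_mul,
      LaurentPolynomial.invert_C, LaurentPolynomial.invert_T, sub_eq_add_neg, ← T_mul_T, map_pow,
      map_neg, map_one]
    ring_nf
  have hnm : n = -n - m := by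
    have h1 := congrArg (fun f => f.coeff n) hn
    simp only [mul_comm _ (C _), ← LaurentPolynomial.smul_eq_C_mul, AddMonoidAlgebra.coeff_smul,
      Finsupp.smul_apply, LaurentPolynomial.T_apply, smul_eq_mul, if_true, mul_one] at h1
    by_contra hne
    rw [if_neg (Ne.symm hne), mul_zero] at h1
    exact hc h1
  have hm2 : m = 0 ∨ m = 2 := by omega
  rcases hm2 with rfl | rfl
  · obtain rfl : n = 0 := by omega
    refine ⟨C d, ?_⟩
    rw [← hu] at hd ⊢
    simp at hd ⊢
    rw [hd, map_pow, sq]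
  · obtain rfl : n = -1 := by push_cast at hnm; omega
    rw [← hu] at hd
    obtain ⟨r, hr⟩ : IsSquare (-c) := isSquare_neg_of_four_mul (d := d) (by
      have h1 : evalUnit (-1 : Fˣ) (T 1) = -1 := by simp
      have h2 : evalUnit (-1 : Fˣ) (T (-1)) = -1 := by simp
      rw [← hd, map_mul, map_mul, map_pow, map_sub, map_one, evalUnit_C, h1, h2]
      ring)
    refine ⟨C r * (T 1 - 1), ?_⟩
    rw [← hu, map_mul, invert_T_one_sub_one, LaurentPolynomial.invert_C]
    have h1 : (C c : F[T;T⁻¹]) = -(C r * C r) := by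
      rw [← map_mul, ← hr, map_neg, neg_neg]
    rw [h1]
    ring

/-- In rank `2` there are isotropic vectors since the determinant is a norm. -/
theorem IsElementary.exists_isotropic_of_rank_two [Finite F] {h : SesqForm F M} (hh : IsAlt h)
    (he : IsElementary h) (b : Basis (Fin 2) F[T;T⁻¹] M) : ∃ v ≠ 0, h v v = 0 := by
  by_cases ha : h (b 0) (b 0) = 0
  · exact ⟨b 0, b.ne_zero 0, ha⟩
  set a := h (b 0) (b 0) with ha_def
  set β := h (b 0) (b 1) with hβ_def
  set d := h (b 1) (b 1) with hd_def
  have hba : h (b 1) (b 0) = -invert β := hh.swap _ _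
  have ha' : invert a = -a := hh.anti _ _
  have hd' : invert d = -d := hh.anti _ _
  have hD : invert (a * d + β * invert β) = a * d + β * invert β := by
    rw [map_add, map_mul, map_mul, ha', hd', invert_invert]
    ring
  -- The left side is the Gram determinant. Representing both coordinate functionals inverts the
  -- Gram matrix up to $x-1$; the final combination is the determinant of that identity.
  have hdvd : a * d + β * invert β ∣ (T 1 - 1) ^ 2 := by
    obtain ⟨u, hu⟩ := he (b.coord 0)
    obtain ⟨w, hw⟩ := he (b.coord 1)
    have hexp : ∀ z y,
        h z y = invert (b.repr z 0) * h (b 0) y + invert (b.repr z 1) * h (b 1) y := by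
      intro z y
      conv_lhs => rw [← b.sum_repr z, Fin.sum_univ_two]
      simp [bar_apply]
    have u0 := hu (b 0)
    have u1 := hu (b 1)
    have w1 := hw (b 1)
    rw [hexp] at u0 u1 w1
    simp only [Basis.coord_apply, Basis.repr_self, Finsupp.single_eq_same, mul_one, hba, ← ha_def,
      ← hβ_def, ← hd_def, ne_eq, zero_ne_one, not_false_eq_true,
      Finsupp.single_eq_of_ne, mul_zero] at u0 u1 w1
    refine ⟨invert (b.repr u 0) * invert (b.repr w 1) -
      invert (b.repr u 1) * invert (b.repr w 0), ?_⟩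
    linear_combination (invert (b.repr w 0) * a - invert (b.repr w 1) * invert β) * u1 -
      (invert (b.repr w 0) * β + invert (b.repr w 1) * d) * u0 - (T 1 - 1) * w1
  obtain ⟨g, hg⟩ := hh.exists_apply_self (b 0)
  -- The involution is invisible at $-1$, so $a=g-\bar g$ vanishes there and the determinant takes
  -- the value $\beta(-1)^2$.
  obtain ⟨δ, hδ⟩ := exists_eq_mul_invert hD hdvd (d := evalUnit (-1) β) (by
    rw [map_add, map_mul, map_mul, evalUnit_invert (by simp), ← ha_def.symm, hg, map_sub,
      evalUnit_invert (by simp)]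
    ring)
  -- As in the quadratic formula: the value of the form on this vector is $a(\delta\bar\delta-D)$,
  -- with $D$ the determinant.
  refine ⟨(δ - β) • b 0 + a • b 1, fun h0 => ha ?_, ?_⟩
  · have := congrArg (b.coord 1) h0
    simpa using this
  · simp only [map_add, map_smul, LinearMap.add_apply, LinearMap.map_smulₛₗ₂, smul_eq_mul,
      ← ha_def, ← hβ_def, ← hd_def, hba, bar_apply, map_sub, ha']
    linear_combination (-a) * hδ

theorem IsElementary.exists_isotropic [Finite F] [Module.Free F[T;T⁻¹] M]
    [Module.Finite F[T;T⁻¹] M] [Nontrivial M] {h : SesqForm F M} (hh : IsAlt h)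
    (he : IsElementary h) : ∃ v ≠ 0, h v v = 0 := by
  have b := Module.finBasis F[T;T⁻¹] M
  have hpos := Module.finrank_pos (R := F[T;T⁻¹]) (M := M)
  rcases hn : Module.finrank F[T;T⁻¹] M with _ | _ | _ | n
  · omega
  · rw [hn] at b
    exact (IsElementary.false_of_rank_one (κ := Fin 1) hh he b).elim
  · rw [hn] at b
    exact he.exists_isotropic_of_rank_two hh b
  · exact hh.exists_isotropic_of_three_le b (by simp [hn])

end Isotropic

/-! ### Decomposition of elementary forms by induction on the rank. -/

section Decomposition

open LaurentPolynomial (T C invert)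
open Module

variable {F : Type*} [Field F]

/-- An elementary form is an orthogonal sum of copies of `ξ` and `λ₁`. -/
theorem IsElementary.exists_decomposition [Finite F] {M : Type*} [AddCommGroup M]
    [Module F[T;T⁻¹] M] [Module.Free F[T;T⁻¹] M] [Module.Finite F[T;T⁻¹] M] {h : SesqForm F M}
    (hh : IsAlt h) (he : IsElementary h) :
    ∃ (τ : Type) (_ : Fintype τ) (d : τ → F[T;T⁻¹]) (b : Basis (τ × Fin 2) F[T;T⁻¹] M),
      (∀ i, d i = 1 ∨ d i = T 1 - 1) ∧ (∀ x i j, h (b (x, i)) (b (x, j)) = planeGram (d x) i j) ∧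
      ∀ x y i j, x ≠ y → h (b (x, i)) (b (y, j)) = 0 := by
  induction hn : Module.finrank F[T;T⁻¹] M using Nat.strong_induction_on generalizing M with
  | _ n ih =>
  rcases subsingleton_or_nontrivial M with hM | hM
  · exact ⟨Empty, inferInstance, Empty.elim, Basis.empty M, fun i => i.elim, fun x => x.elim,
      fun x => x.elim⟩
  obtain ⟨v₀, hv₀, hv₀'⟩ := he.exists_isotropic hh
  obtain ⟨c, v, φ, hc, rfl, hφ⟩ := exists_smul_eq_of_ne_zero (R := F[T;T⁻¹]) hv₀
  have hv : h v v = 0 := by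
    have hc' : invert c ≠ 0 := by simpa using hc
    simpa [LinearMap.map_smulₛₗ₂, bar_apply, hc, hc'] using hv₀'
  obtain ⟨w, d₀, hd₀, hw, hvw, dv, dw⟩ := he.exists_plane hh hv hφ
  have hd₀' : d₀ ≠ 0 := by
    rcases hd₀ with rfl | rfl
    · exact one_ne_zero
    · exact T_one_sub_one_ne_zero
  obtain ⟨e, hs⟩ := hh.exists_splitting hd₀' hv hw hvw dv dw
  have hrank : Module.finrank F[T;T⁻¹] M = 2 + Module.finrank F[T;T⁻¹] (orthPair h v w) := by
    rw [← e.finrank_eq, Module.finrank_prod, Module.finrank_fin_fun]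
  obtain ⟨τ, _, d, b, hd, hb, hb'⟩ := ih _ (by omega) (hh.restrict (orthPair h v w))
    (he.restrict_orthPair e hs) rfl
  let B := (((Pi.basisFun F[T;T⁻¹] (Fin 2)).prod b).map e).reindex
    (optionProdEquiv (α := τ) (β := Fin 2)).symm
  have B0 : B (none, 0) = v := by
    simp [B, hs]
  have B1 : B (none, 1) = w := by
    simp [B, hs]
  have B2 : ∀ x i, B (some x, i) = b (x, i) := by
    intro x i
    simp [B, hs]
  have hvB : ∀ x i, h v (B (some x, i)) = 0 := fun x i => by
    rw [B2]; exact (b (x, i)).2.1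
  have hwB : ∀ x i, h w (B (some x, i)) = 0 := fun x i => by
    rw [B2]; exact (b (x, i)).2.2
  refine ⟨Option τ, inferInstance, fun o => o.elim d₀ d, B, ?_, ?_, ?_⟩
  · rintro (_ | x)
    · exact hd₀
    · exact hd x
  · rintro (_ | x) i j
    · fin_cases i <;> fin_cases j <;> simp [B0, B1, hv, hw, hvw, planeGram, hh.swap v w]
    · rw [B2, B2]
      exact hb x i j
  · rintro (_ | x) (_ | y) i j hxy
    · exact (hxy rfl).elim
    · fin_cases i
      · simp [B0, hvB]
      · simp [B1, hwB]
    · fin_cases j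
      · simp [B0, hh.swap _ (B (some x, i)), hvB]
      · simp [B1, hh.swap _ (B (some x, i)), hwB]
    · rw [B2, B2]
      exact hb' x y i j fun hxy' => hxy (congrArg some hxy')

end Decomposition

end LaurentForm

namespace LaurentForm

/-! ### Coarsening respects products, the involution and congruence. -/

section Coarsening

open LaurentPolynomial (T C invert)

variable {F : Type*} [CommRing F] {ι κ μ : Type*}

theorem coeff_invert (f : F[T;T⁻¹]) (n : ℤ) : (invert f).coeff n = f.coeff (-n) := by
  simp

theorem dagger_apply (M : Matrix ι κ F[T;T⁻¹]) (i : κ) (j : ι) : dagger M i j = invert (M j i) :=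
  rfl

theorem dagger_mul [Fintype κ] (A : Matrix ι κ F[T;T⁻¹]) (B : Matrix κ μ F[T;T⁻¹]) :
    dagger (A * B) = dagger B * dagger A := by
  ext1 i j
  simp [dagger_apply, Matrix.mul_apply, mul_comm]

theorem dagger_one [DecidableEq ι] : dagger (1 : Matrix ι ι F[T;T⁻¹]) = 1 := by
  ext1 i j
  rcases eq_or_ne i j with rfl | h
  · simp [dagger_apply]
  · simp [dagger_apply, h, h.symm]

theorem coeff_sum_phi_mul_T (b : ℕ+) (c : Fin b → F[T;T⁻¹]) (i : Fin b) (k : ℤ) :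
    (∑ r : Fin b, phi F b (c r) * T (r : ℤ)).coeff (b * k + i) = (c i).coeff k := by
  have hb : (b : ℤ) ≠ 0 := by exact_mod_cast b.ne_zero
  rw [AddMonoidAlgebra.coeff_sum, Finsupp.finsetSum_apply, Finset.sum_eq_single i]
  · rw [coeff_mul_T, coeff_phi, add_sub_cancel_right, if_pos (dvd_mul_right _ _),
      Int.mul_ediv_cancel_left _ hb]
  · intro r _ hr
    rw [coeff_mul_T, coeff_phi, if_neg]
    intro hdvd
    have h1 : (b : ℤ) ∣ i - r := by
      have := dvd_sub hdvd (dvd_mul_right (b : ℤ) k)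
      rwa [show (b : ℤ) * k + i - r - b * k = i - r by ring] at this
    have hi := i.2
    have hr' := r.2
    have := Int.eq_zero_of_abs_lt_dvd h1 (by rw [abs_lt]; omega)
    exact hr (Fin.ext (by omega))
  · simp

theorem sum_phi_mul_T_injective (b : ℕ+) {c c' : Fin b → F[T;T⁻¹]}
    (h : ∑ r : Fin b, phi F b (c r) * T (r : ℤ) = ∑ r : Fin b, phi F b (c' r) * T (r : ℤ)) :
    c = c' := by
  ext i k
  rw [← coeff_sum_phi_mul_T, h, coeff_sum_phi_mul_T]

/-- By `mul_T_eq_sum_coarsen` the coarsened matrix is that of the same linear map in the bases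
$x^ie_u$, and expansions in $1,\dots,x^{b-1}$ are unique. -/
theorem coarsen_mul [Fintype κ] (b : ℕ+) (A : Matrix ι κ F[T;T⁻¹]) (B : Matrix κ μ F[T;T⁻¹]) :
    coarsen b (A * B) = coarsen b A * coarsen b B := by
  ext1 ⟨u, i⟩ ⟨v, j⟩
  refine congrFun (sum_phi_mul_T_injective b (c := fun i => coarsen b (A * B) (u, i) (v, j))
    (c' := fun i => (coarsen b A * coarsen b B) (u, i) (v, j)) ?_) i
  have h1 := mul_T_eq_sum_coarsen b (A * B) u (v, j)
  rw [← h1]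
  simp only [Matrix.mul_apply, Finset.sum_mul, map_sum, map_mul]
  rw [Finset.sum_comm, Fintype.sum_prod_type]
  refine Finset.sum_congr rfl fun w _ => ?_
  have h2 := mul_T_eq_sum_coarsen b B w (v, j)
  rw [mul_assoc]
  simp only at h2
  rw [h2, Finset.mul_sum]
  refine Finset.sum_congr rfl fun r _ => ?_
  have h3 := mul_T_eq_sum_coarsen b A u (w, r)
  simp only at h3
  rw [mul_left_comm, h3, Finset.mul_sum]
  exact Finset.sum_congr rfl fun i _ => by ring

theorem coarsen_dagger (b : ℕ+) (A : Matrix ι κ F[T;T⁻¹]) :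
    coarsen b (dagger A) = dagger (coarsen b A) := by
  ext1 u v
  ext k
  rw [dagger_apply, coeff_invert, coeff_coarsen, coeff_coarsen, dagger_apply, coeff_invert]
  congr 1
  ring

/-- $x^{bn}$ acts as $y^n$; this turns an inverse up to $x^b-1$ into one up to $y-1$. -/
theorem coarsen_scalar [DecidableEq ι] (b : ℕ+) (n : ℤ) :
    coarsen b ((T (b * n) : F[T;T⁻¹]) • (1 : Matrix ι ι F[T;T⁻¹])) = (T n : F[T;T⁻¹]) • 1 := by
  have hb : (0 : ℤ) < b := by exact_mod_cast b.pos
  ext1 ⟨u, i⟩ ⟨v, j⟩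
  ext k
  rw [coeff_coarsen]
  simp only [Matrix.smul_apply, Matrix.one_apply, smul_eq_mul, mul_ite, mul_one, mul_zero,
    Prod.mk.injEq]
  by_cases huv : u = v
  · by_cases hij : i = j
    · subst huv hij
      simp
    · have hne : (b : ℤ) * n ≠ b * k + i - j := by
        intro h1
        have h2 : (b : ℤ) ∣ i - j := ⟨n - k, by linarith⟩
        have hi := i.2
        have hj := j.2
        have := Int.eq_zero_of_abs_lt_dvd h2 (by rw [abs_lt]; omega)
        exact hij (Fin.ext (by omega))
      simp [huv, hij, hne]
  · simp [huv]

theorem coarsen_one [DecidableEq ι] (b : ℕ+) :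
    coarsen b (1 : Matrix ι ι F[T;T⁻¹]) = 1 := by
  simpa using coarsen_scalar (F := F) (ι := ι) b 0

theorem coarsen_sub (b : ℕ+) (A B : Matrix ι κ F[T;T⁻¹]) :
    coarsen b (A - B) = coarsen b A - coarsen b B := by
  ext1 u v
  ext k
  simp [coeff_coarsen]

theorem IsAntiHermitian.coarsen {A : Matrix ι ι F[T;T⁻¹]} (hA : IsAntiHermitian A) (b : ℕ+) :
    IsAntiHermitian (coarsen b A) := by
  rw [IsAntiHermitian, ← coarsen_dagger, hA, ← zero_sub, coarsen_sub]
  ext1 u v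
  ext k
  simp [coeff_coarsen]

theorem DiagZeroConst.coarsen {A : Matrix ι ι F[T;T⁻¹]} (hA : DiagZeroConst A) (b : ℕ+) :
    DiagZeroConst (coarsen b A) := by
  intro i
  rw [coeff_coarsen, mul_zero, zero_add, sub_self]
  exact hA i.1

variable [Fintype ι] [DecidableEq ι] [Fintype κ] [DecidableEq κ] [Fintype μ] [DecidableEq μ]

theorem Congruent.coarsen {A : Matrix ι ι F[T;T⁻¹]} {B : Matrix κ κ F[T;T⁻¹]}
    (h : Congruent A B) (b : ℕ+) : Congruent (coarsen b A) (coarsen b B) := by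
  obtain ⟨E, E', h1, h2, h3⟩ := h
  refine ⟨LaurentForm.coarsen b E, LaurentForm.coarsen b E', ?_, ?_, ?_⟩
  · rw [← coarsen_mul, h1, coarsen_one]
  · rw [← coarsen_mul, h2, coarsen_one]
  · rw [← coarsen_dagger, ← coarsen_mul, ← coarsen_mul, h3]

theorem Congruent.trans {A : Matrix ι ι F[T;T⁻¹]} {B : Matrix κ κ F[T;T⁻¹]}
    {D : Matrix μ μ F[T;T⁻¹]} (h : Congruent A B) (h' : Congruent B D) : Congruent A D := by
  obtain ⟨E, E', h1, h2, rfl⟩ := h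
  obtain ⟨G, G', h4, h5, rfl⟩ := h'
  refine ⟨E * G, G' * E', ?_, ?_, ?_⟩
  · rw [← Matrix.mul_assoc, Matrix.mul_assoc E, h4, Matrix.mul_one, h1]
  · rw [← Matrix.mul_assoc, Matrix.mul_assoc G', h2, Matrix.mul_one, h5]
  · simp only [dagger_mul, Matrix.mul_assoc]

theorem congruent_of_equiv {A : Matrix ι ι F[T;T⁻¹]} {B : Matrix κ κ F[T;T⁻¹]} (e : κ ≃ ι)
    (h : ∀ i j, A (e i) (e j) = B i j) : Congruent A B := by
  refine ⟨(1 : Matrix ι ι _).submatrix id e, (1 : Matrix ι ι _).submatrix e id, ?_, ?_, ?_⟩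
  · rw [Matrix.submatrix_mul_equiv]
    simp
  · rw [← Matrix.submatrix_mul _ _ _ _ _ Function.bijective_id]
    simp
  · ext1 i j
    simp [Matrix.mul_apply, dagger_apply, Matrix.one_apply, apply_ite, h]

theorem Congruent.fromBlocks_zero {A : Matrix ι ι F[T;T⁻¹]} {B : Matrix κ κ F[T;T⁻¹]}
    (h : Congruent A B) : Congruent (fromBlocks A 0 0 (0 : Matrix μ μ F[T;T⁻¹]))
      (fromBlocks B 0 0 (0 : Matrix μ μ F[T;T⁻¹])) := by
  obtain ⟨E, E', h1, h2, rfl⟩ := h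
  refine ⟨fromBlocks E 0 0 1, fromBlocks E' 0 0 1, ?_, ?_, ?_⟩
  · simp [fromBlocks_multiply, h1]
  · simp [fromBlocks_multiply, h2]
  · have h3 : dagger (fromBlocks E 0 0 (1 : Matrix μ μ F[T;T⁻¹])) =
        fromBlocks (dagger E) 0 0 1 := by
      ext1 i j
      rcases i with i | i <;> rcases j with j | j
      · simp [dagger_apply]
      · simp [dagger_apply]
      · simp [dagger_apply]
      · exact congrFun (congrFun (dagger_one (F := F) (ι := μ)) i) j
    rw [h3]
    simp [fromBlocks_multiply]

end Coarsening

/-! ### Coordinates over the coarse ring. -/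

section SplitVec

open LaurentPolynomial (T C invert)

variable {F : Type*} [CommRing F] {ι : Type*}

/-- The coordinates of a vector over the coarse ring. -/
noncomputable def splitVec (b : ℕ+) (u : ι → F[T;T⁻¹]) : ι × Fin b → F[T;T⁻¹] :=
  fun x => coarsen b (replicateCol Unit u) x ((), ⟨0, b.pos⟩)

theorem coeff_splitVec (b : ℕ+) (u : ι → F[T;T⁻¹]) (x : ι × Fin b) (k : ℤ) :
    (splitVec b u x).coeff k = (u x.1).coeff (b * k + x.2) := by
  simp [splitVec, coeff_coarsen]

/-- Passing to coordinates over the coarse ring is bijective. -/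
noncomputable def splitVecEquiv (b : ℕ+) : (ι → F[T;T⁻¹]) ≃+ (ι × Fin b → F[T;T⁻¹]) :=
  AddEquiv.ofBijective (⟨⟨splitVec b, by ext; simp [coeff_splitVec]⟩, fun u v => by
    ext x k; simp [coeff_splitVec]⟩ : (ι → F[T;T⁻¹]) →+ (ι × Fin b → F[T;T⁻¹])) (by
  have hb : (0 : ℤ) < b := by exact_mod_cast b.pos
  constructor
  · intro u v huv
    ext i n
    have h1 := Int.emod_nonneg n hb.ne'
    have h2 := Int.emod_lt_of_pos n hb
    have h3 := congrArg (fun f => (f (i, ⟨(n % b).toNat, by omega⟩)).coeff (n / b)) huv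
    have h4 : (b : ℤ) * (n / b) + (n % b).toNat = n := by
      rw [Int.toNat_of_nonneg h1]
      exact Int.mul_ediv_add_emod n b
    simp only [AddMonoidHom.coe_mk, ZeroHom.coe_mk, coeff_splitVec, h4] at h3
    exact h3
  · intro w
    refine ⟨fun i => ∑ r : Fin b, phi F b (w (i, r)) * T (r : ℤ), ?_⟩
    ext ⟨i, r⟩ k
    simp only [AddMonoidHom.coe_mk, ZeroHom.coe_mk, coeff_splitVec]
    exact coeff_sum_phi_mul_T b (fun r => w (i, r)) r k)

theorem splitVecEquiv_apply (b : ℕ+) (u : ι → F[T;T⁻¹]) : splitVecEquiv b u = splitVec b u := rfl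

end SplitVec

/-! ### The torsion count of the cokernel, invariant under congruence and coarsening. -/

section Invariant

open LaurentPolynomial (T C invert)

variable {F : Type*} [CommRing F] {ι κ : Type*} [Fintype ι] [Fintype κ]

/-- The image of a matrix. -/
noncomputable def imageSubgroup (A : Matrix ι ι F[T;T⁻¹]) : AddSubgroup (ι → F[T;T⁻¹]) :=
  (LinearMap.range A.mulVecLin).toAddSubgroup

theorem mem_imageSubgroup {A : Matrix ι ι F[T;T⁻¹]} {u : ι → F[T;T⁻¹]} :
    u ∈ imageSubgroup A ↔ ∃ w, A *ᵥ w = u := Iff.rfl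

theorem smul_mem_imageSubgroup {A : Matrix ι ι F[T;T⁻¹]} {u : ι → F[T;T⁻¹]}
    (hu : u ∈ imageSubgroup A) (f : F[T;T⁻¹]) : f • u ∈ imageSubgroup A :=
  (LinearMap.range A.mulVecLin).smul_mem f hu

theorem smul_mem_imageSubgroup_of_dvd {A : Matrix ι ι F[T;T⁻¹]} {u : ι → F[T;T⁻¹]}
    {f g : F[T;T⁻¹]} (hfg : f ∣ g) (hu : f • u ∈ imageSubgroup A) : g • u ∈ imageSubgroup A := by
  obtain ⟨r, rfl⟩ := hfg
  rw [mul_comm, mul_smul]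
  exact smul_mem_imageSubgroup hu r

/-- The vectors that represent elements of the cokernel fixed by a power of the variable. -/
noncomputable def torsionSubgroup (A : Matrix ι ι F[T;T⁻¹]) : AddSubgroup (ι → F[T;T⁻¹]) where
  carrier := {u | ∃ k : ℕ+, (T (k : ℤ) - 1 : F[T;T⁻¹]) • u ∈ imageSubgroup A}
  zero_mem' := ⟨1, by rw [smul_zero]; exact zero_mem _⟩
  neg_mem' := by
    rintro u ⟨k, hk⟩
    exact ⟨k, by rw [smul_neg]; exact neg_mem hk⟩
  add_mem' := by
    rintro u v ⟨k, hk⟩ ⟨l, hl⟩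
    -- $x^{kl}-1$ is a common multiple of $x^k-1$ and $x^l-1$.
    refine ⟨k * l, ?_⟩
    rw [smul_add]
    refine add_mem (smul_mem_imageSubgroup_of_dvd ?_ hk) (smul_mem_imageSubgroup_of_dvd ?_ hl)
    · exact_mod_cast T_sub_one_dvd (F := F) k l
    · rw [mul_comm]
      exact_mod_cast T_sub_one_dvd (F := F) l k

theorem mem_torsionSubgroup {A : Matrix ι ι F[T;T⁻¹]} {u : ι → F[T;T⁻¹]} :
    u ∈ torsionSubgroup A ↔ ∃ k : ℕ+, (T (k : ℤ) - 1 : F[T;T⁻¹]) • u ∈ imageSubgroup A := Iff.rfl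

/-- The number of torsion elements of the cokernel. -/
noncomputable def torsionCard (A : Matrix ι ι F[T;T⁻¹]) : ℕ :=
  (imageSubgroup A).relIndex (torsionSubgroup A)

/-- Only additive maps are required, since coarsening changes the scalars. -/
theorem torsionCard_eq_of_addEquiv {A : Matrix ι ι F[T;T⁻¹]} {B : Matrix κ κ F[T;T⁻¹]}
    (θ : (ι → F[T;T⁻¹]) ≃+ (κ → F[T;T⁻¹]))
    (him : ∀ u, θ u ∈ imageSubgroup B ↔ u ∈ imageSubgroup A)
    (htor : ∀ u, θ u ∈ torsionSubgroup B ↔ u ∈ torsionSubgroup A) :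
    torsionCard B = torsionCard A := by
  have h1 : (imageSubgroup A).map θ.toAddMonoidHom = imageSubgroup B := by
    ext u
    obtain ⟨u, rfl⟩ := θ.surjective u
    simp [him]
  have h2 : (torsionSubgroup A).map θ.toAddMonoidHom = torsionSubgroup B := by
    ext u
    obtain ⟨u, rfl⟩ := θ.surjective u
    simp [htor]
  rw [torsionCard, torsionCard, ← h1, ← h2]
  exact AddSubgroup.relIndex_map_map_of_injective _ _ θ.injective

theorem Congruent.torsionCard_eq [DecidableEq ι] [DecidableEq κ] {A : Matrix ι ι F[T;T⁻¹]}
    {B : Matrix κ κ F[T;T⁻¹]} (h : Congruent A B) : torsionCard B = torsionCard A := by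
  obtain ⟨E, E', h1, h2, rfl⟩ := h
  have h3 : dagger E * dagger E' = 1 := by rw [← dagger_mul, h2, dagger_one]
  have h4 : dagger E' * dagger E = 1 := by rw [← dagger_mul, h1, dagger_one]
  let θ : (ι → F[T;T⁻¹]) ≃+ (κ → F[T;T⁻¹]) :=
    { toFun := fun u => dagger E *ᵥ u
      invFun := fun u => dagger E' *ᵥ u
      left_inv := fun u => by simp only [mulVec_mulVec, h4, one_mulVec]
      right_inv := fun u => by simp only [mulVec_mulVec, h3, one_mulVec]
      map_add' := fun u v => mulVec_add _ _ _ }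
  have hsmul : ∀ (f : F[T;T⁻¹]) u, θ (f • u) = f • θ u := fun f u => mulVec_smul _ _ _
  have him : ∀ u, θ u ∈ imageSubgroup (dagger E * A * E) ↔ u ∈ imageSubgroup A := by
    intro u
    rw [mem_imageSubgroup, mem_imageSubgroup]
    constructor
    · rintro ⟨w, hw⟩
      refine ⟨E *ᵥ w, θ.injective ?_⟩
      rw [← hw]
      simp [θ, mulVec_mulVec, Matrix.mul_assoc]
    · rintro ⟨w, rfl⟩
      refine ⟨E' *ᵥ w, ?_⟩
      simp [θ, mulVec_mulVec, Matrix.mul_assoc, h1]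
  refine torsionCard_eq_of_addEquiv θ him fun u => ?_
  simp only [mem_torsionSubgroup, ← hsmul, him]

theorem splitVec_mulVec (b : ℕ+) (A : Matrix ι ι F[T;T⁻¹]) (u : ι → F[T;T⁻¹]) :
    splitVec b (A *ᵥ u) = coarsen b A *ᵥ splitVec b u := by
  ext1 x
  rw [splitVec, replicateCol_mulVec, coarsen_mul]
  rfl

/-- $y^k-1$ acts as $x^{bk}-1$; conversely $x^k-1$ divides $x^{bk}-1$, so allowing every $k$ gives
the same torsion on both sides. -/
theorem torsionCard_coarsen (b : ℕ+) (A : Matrix ι ι F[T;T⁻¹]) :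
    torsionCard (coarsen b A) = torsionCard A := by
  have hsmul : ∀ (k : ℤ) (u : ι → F[T;T⁻¹]), splitVecEquiv b ((T (b * k) - 1 : F[T;T⁻¹]) • u) =
      (T k - 1 : F[T;T⁻¹]) • splitVecEquiv b u := by
    intro k u
    ext x n
    simp only [splitVecEquiv_apply, coeff_splitVec, Pi.smul_apply, smul_eq_mul, sub_mul, one_mul,
      LaurentPolynomial.T_mul, AddMonoidAlgebra.coeff_sub, Finsupp.sub_apply, coeff_mul_T]
    congr 2
    ring
  have him : ∀ u, splitVecEquiv b u ∈ imageSubgroup (coarsen b A) ↔ u ∈ imageSubgroup A := by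
    intro u
    rw [mem_imageSubgroup, mem_imageSubgroup]
    constructor
    · rintro ⟨w, hw⟩
      obtain ⟨w, rfl⟩ := (splitVecEquiv b).surjective w
      refine ⟨w, (splitVecEquiv b).injective ?_⟩
      rw [← hw]
      exact splitVec_mulVec b A w
    · rintro ⟨w, rfl⟩
      exact ⟨splitVec b w, (splitVec_mulVec b A w).symm⟩
  refine torsionCard_eq_of_addEquiv (splitVecEquiv b) him fun u => ?_
  simp only [mem_torsionSubgroup, ← hsmul, him]
  constructor
  · rintro ⟨k, hk⟩
    exact ⟨b * k, by exact_mod_cast hk⟩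
  · rintro ⟨k, hk⟩
    refine ⟨k, smul_mem_imageSubgroup_of_dvd ?_ hk⟩
    rw [mul_comm]
    exact T_sub_one_dvd _ _

theorem normalForm_mulVec (s t z : ℕ)
    (w : (Fin 2 × Fin s) ⊕ ((Fin 2 × Fin t) ⊕ Fin z) → F[T;T⁻¹]) :
    (∀ a, (normalForm F s t z *ᵥ w) (.inl (0, a)) = (T 1 - 1) * w (.inl (1, a))) ∧
    (∀ a, (normalForm F s t z *ᵥ w) (.inl (1, a)) = (T 1 - 1) * (T (-1) * w (.inl (0, a)))) ∧
    (∀ a, (normalForm F s t z *ᵥ w) (.inr (.inl (0, a))) = w (.inr (.inl (1, a)))) ∧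
    (∀ a, (normalForm F s t z *ᵥ w) (.inr (.inl (1, a))) = -w (.inr (.inl (0, a)))) ∧
    ∀ a, (normalForm F s t z *ᵥ w) (.inr (.inr a)) = 0 := by
  have hT : (-T (-1) + 1 : F[T;T⁻¹]) = (T 1 - 1) * T (-1) := by
    rw [sub_mul, T_mul_T]
    simp
    ring
  refine ⟨fun a => ?_, fun a => ?_, fun a => ?_, fun a => ?_, fun a => ?_⟩ <;>
    simp [mulVec, dotProduct, normalForm, Fintype.sum_prod_type, blockDiagonal_apply, xi, lambdaOne,
      hT, mul_assoc]

theorem mem_imageSubgroup_normalForm (s t z : ℕ)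
    (u : (Fin 2 × Fin s) ⊕ ((Fin 2 × Fin t) ⊕ Fin z) → F[T;T⁻¹]) :
    u ∈ imageSubgroup (normalForm F s t z) ↔
      (∀ x, T 1 - 1 ∣ u (.inl x)) ∧ ∀ a, u (.inr (.inr a)) = 0 := by
  rw [mem_imageSubgroup]
  constructor
  · rintro ⟨w, rfl⟩
    obtain ⟨h1, h2, -, -, h5⟩ := normalForm_mulVec s t z w
    refine ⟨?_, h5⟩
    rintro ⟨i, a⟩
    fin_cases i
    · exact ⟨_, h1 a⟩
    · exact ⟨_, h2 a⟩
  · rintro ⟨h1, h2⟩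
    choose r hr using h1
    let w : (Fin 2 × Fin s) ⊕ ((Fin 2 × Fin t) ⊕ Fin z) → F[T;T⁻¹] :=
      Sum.elim (fun x => if x.1 = 0 then T 1 * r (1, x.2) else r (0, x.2))
        (Sum.elim (fun x => if x.1 = 0 then -u (.inr (.inl (1, x.2))) else u (.inr (.inl (0, x.2))))
          0)
    obtain ⟨h3, h4, h5, h6, h7⟩ := normalForm_mulVec s t z w
    refine ⟨w, ?_⟩
    ext1 x
    rcases x with ⟨i, a⟩ | ⟨i, a⟩ | a
    · fin_cases i
      · exact (h3 a).trans (by simp [w, hr])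
      · exact (h4 a).trans (by simp [w, hr, ← mul_assoc])
    · fin_cases i
      · exact (h5 a).trans (by simp [w])
      · exact (h6 a).trans (by simp [w])
    · exact (h7 a).trans (h2 a).symm

end Invariant

/-! ### The torsion count of the normal form. -/

section Field

open LaurentPolynomial (T C invert)

variable {F : Type*} [Field F]

theorem T_sub_one_ne_zero (k : ℕ+) : (T (k : ℤ) - 1 : F[T;T⁻¹]) ≠ 0 := by
  intro h
  have := congrArg (fun f => f.coeff 0) h
  simp [← LaurentPolynomial.T_zero] at this

theorem mem_torsionSubgroup_normalForm (s t z : ℕ)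
    (u : (Fin 2 × Fin s) ⊕ ((Fin 2 × Fin t) ⊕ Fin z) → F[T;T⁻¹]) :
    u ∈ torsionSubgroup (normalForm F s t z) ↔ ∀ a, u (.inr (.inr a)) = 0 := by
  rw [mem_torsionSubgroup]
  simp only [mem_imageSubgroup_normalForm, Pi.smul_apply, smul_eq_mul, mul_eq_zero,
    T_sub_one_ne_zero, false_or]
  exact ⟨fun ⟨k, h⟩ => h.2, fun h => ⟨1, fun x => dvd_mul_right _ _, h⟩⟩

/-- Evaluating the $\xi$-coordinates at 1 maps the torsion vectors onto $F^{2s}$ with the image of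
the matrix as kernel. -/
theorem torsionCard_normalForm (s t z : ℕ) :
    torsionCard (normalForm F s t z) = Nat.card F ^ (2 * s) := by
  let ψ : torsionSubgroup (normalForm F s t z) →+ (Fin 2 × Fin s → F) :=
    { toFun := fun u x => evalUnit 1 (u.1 (.inl x))
      map_zero' := by ext; simp
      map_add' := fun u v => by ext; simp }
  have hker : (imageSubgroup (normalForm F s t z)).addSubgroupOf
      (torsionSubgroup (normalForm F s t z)) = ψ.ker := by
    ext ⟨u, hu⟩
    rw [AddSubgroup.mem_addSubgroupOf, mem_imageSubgroup_normalForm, AddMonoidHom.mem_ker]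
    simp only [← evalUnit_one_eq_zero_iff, (mem_torsionSubgroup_normalForm s t z u).1 hu,
      implies_true, and_true, funext_iff]
    rfl
  have hsurj : Function.Surjective ψ := by
    intro c
    refine ⟨⟨Sum.elim (fun x => C (c x)) 0, ?_⟩, ?_⟩
    · rw [mem_torsionSubgroup_normalForm]
      simp
    · ext x
      simp [ψ]
  rw [torsionCard, AddSubgroup.relIndex, hker, AddSubgroup.index_ker,
    AddMonoidHom.range_eq_top.2 hsurj]
  simp [Nat.card_fun]

end Field

end LaurentForm

namespace LaurentForm

/-! ### From matrices to forms and back; the radical; existence of the normal form. -/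

section MatrixForm

open LaurentPolynomial (T C invert)
open Module

variable {F : Type*} [Field F] {ι κ : Type*} [Fintype ι] [Fintype κ]

/-- The form with a given Gram matrix. -/
noncomputable def matrixForm (A : Matrix ι ι F[T;T⁻¹]) : SesqForm F (ι → F[T;T⁻¹]) :=
  LinearMap.mk₂'ₛₗ (bar F) (RingHom.id _) (fun v w => (fun i => bar F (v i)) ⬝ᵥ (A *ᵥ w))
    (fun v v' w => by simp [dotProduct, add_mul, Finset.sum_add_distrib])
    (fun c v w => by simp [dotProduct, mul_assoc, Finset.mul_sum])
    (fun v w w' => by simp [mulVec_add])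
    (fun c v w => by simp [mulVec_smul])

theorem matrixForm_apply (A : Matrix ι ι F[T;T⁻¹]) (v w : ι → F[T;T⁻¹]) :
    matrixForm A v w = (fun i => invert (v i)) ⬝ᵥ (A *ᵥ w) := rfl

theorem matrixForm_single [DecidableEq ι] (A : Matrix ι ι F[T;T⁻¹]) (i j : ι) :
    matrixForm A (Pi.single i 1) (Pi.single j 1) = A i j := by
  have h : (fun k => invert ((Pi.single i 1 : ι → F[T;T⁻¹]) k)) = Pi.single i 1 := by
    ext1 k
    rcases eq_or_ne k i with rfl | hk
    · simp
    · simp [hk]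
  rw [matrixForm_apply, h]
  simp

theorem invert_matrixForm {A : Matrix ι ι F[T;T⁻¹]} (hA : IsAntiHermitian A)
    (v w : ι → F[T;T⁻¹]) : invert (matrixForm A v w) = -matrixForm A w v := by
  have hA' : ∀ i j, invert (A i j) = -A j i := fun i j => congrFun (congrFun hA j) i
  simp only [matrixForm_apply, dotProduct, mulVec, Finset.mul_sum, map_sum, map_mul,
    invert_invert, hA', ← Finset.sum_neg_distrib]
  rw [Finset.sum_comm]
  exact Finset.sum_congr rfl fun i _ => Finset.sum_congr rfl fun j _ => by ring

/-- Cross terms, and diagonal terms $\bar v_iv_iA_{ii}$ with $A_{ii}=g-\bar g$, have the shape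
$f-\bar f$, without constant term in any characteristic. -/
theorem isAlt_matrixForm {A : Matrix ι ι F[T;T⁻¹]} (hA : IsAntiHermitian A)
    (hA₀ : DiagZeroConst A) : IsAlt (matrixForm A) := by
  classical
  refine ⟨invert_matrixForm hA, fun v => ?_⟩
  have hv : v = ∑ i, v i • (Pi.single i 1 : ι → F[T;T⁻¹]) := by
    ext1 j
    simp [Finset.sum_apply, Pi.single_apply]
  rw [hv]
  refine Finset.sum_induction _ (fun v => (matrixForm A v v).coeff 0 = 0) ?_ (by simp) ?_
  · intro v w hv hw
    have h1 : matrixForm A (v + w) (v + w) = matrixForm A v v + matrixForm A w w +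
        (matrixForm A v w - invert (matrixForm A v w)) := by
      rw [invert_matrixForm hA]
      simp
      ring
    rw [h1]
    simp [hv, hw]
  · intro i _
    obtain ⟨g, hg⟩ := exists_eq_sub_invert (f := A i i)
      (congrFun (congrFun hA i) i) (hA₀ i)
    have h1 : matrixForm A (v i • Pi.single i 1) (v i • Pi.single i 1) =
        invert (v i) * v i * g - invert (invert (v i) * v i * g) := by
      rw [LinearMap.map_smulₛₗ₂, map_smul, matrixForm_single, hg, map_mul, map_mul, invert_invert,
        bar_apply, smul_eq_mul, smul_eq_mul]
      ring
    rw [h1, AddMonoidAlgebra.coeff_sub, Finsupp.sub_apply, coeff_invert, neg_zero, sub_self]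

theorem isElementary_matrixForm [DecidableEq ι] {A G : Matrix ι ι F[T;T⁻¹]}
    (hG : G * A = (T 1 - 1 : F[T;T⁻¹]) • 1) : IsElementary (matrixForm A) := by
  intro φ
  let r : ι → F[T;T⁻¹] := fun i => φ (Pi.single i 1)
  refine ⟨fun i => invert ((r ᵥ* G) i), fun w => ?_⟩
  rw [matrixForm_apply]
  simp only [invert_invert]
  rw [dotProduct_mulVec, vecMul_vecMul, hG, vecMul_smul, vecMul_one, smul_dotProduct, smul_eq_mul]
  congr 1
  conv_rhs => rw [← (Pi.basisFun F[T;T⁻¹] ι).sum_repr w]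
  simp [dotProduct, r, mul_comm]

/-- A change of basis gives a congruence. -/
theorem congruent_of_basis [DecidableEq ι] [DecidableEq κ] (A : Matrix ι ι F[T;T⁻¹])
    {B : Matrix κ κ F[T;T⁻¹]} (b : Basis κ F[T;T⁻¹] (ι → F[T;T⁻¹]))
    (h : ∀ i j, matrixForm A (b i) (b j) = B i j) : Congruent A B := by
  refine ⟨(Pi.basisFun F[T;T⁻¹] ι).toMatrix b, b.toMatrix (Pi.basisFun F[T;T⁻¹] ι),
    Basis.toMatrix_mul_toMatrix_flip _ _, Basis.toMatrix_mul_toMatrix_flip _ _, ?_⟩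
  ext1 i j
  rw [← h, matrixForm_apply, Matrix.mul_assoc]
  simp [Matrix.mul_apply, dotProduct, mulVec, dagger_apply, Basis.toMatrix_apply]

/-- Splitting off the radical. -/
theorem exists_congruent_fromBlocks [DecidableEq ι] {A : Matrix ι ι F[T;T⁻¹]}
    (hA : IsAntiHermitian A) : ∃ (m z : ℕ) (B : Matrix (Fin m) (Fin m) F[T;T⁻¹]),
      B.det ≠ 0 ∧ Congruent A (fromBlocks B 0 0 (0 : Matrix (Fin z) (Fin z) F[T;T⁻¹])) := by
  let f := A.mulVecLin
  -- The range is a submodule of a free module over a PID, hence projective, so the kernel of $A$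
  -- has a complement.
  obtain ⟨s, hs⟩ := Module.projective_lifting_property f.rangeRestrict LinearMap.id
    f.surjective_rangeRestrict
  have hs' : ∀ r, A *ᵥ (s r) = r := fun r => congrArg Subtype.val (LinearMap.congr_fun hs r)
  let g : (LinearMap.range f × LinearMap.ker f) →ₗ[F[T;T⁻¹]] (ι → F[T;T⁻¹]) :=
    s.coprod (LinearMap.ker f).subtype
  have hker : ∀ n : LinearMap.ker f, A *ᵥ (n : ι → F[T;T⁻¹]) = 0 := fun n => n.2
  have hg : Function.Bijective g := by
    constructor
    · rw [← LinearMap.ker_eq_bot, LinearMap.ker_eq_bot']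
      rintro ⟨r, n⟩ h
      have h1 : s r + n = 0 := h
      have h2 := congrArg (A *ᵥ ·) h1
      simp only [mulVec_add, hs', hker, mulVec_zero, add_zero] at h2
      have h3 : r = 0 := Subtype.ext h2
      subst h3
      simpa using h1
    · intro v
      refine ⟨(⟨A *ᵥ v, v, rfl⟩, ⟨v - s ⟨A *ᵥ v, v, rfl⟩, ?_⟩), ?_⟩
      · rw [LinearMap.mem_ker]
        change A *ᵥ _ = 0
        rw [mulVec_sub, hs', sub_self]
      · simp [g]
  let c := Module.finBasis F[T;T⁻¹] (LinearMap.range f)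
  let b := (c.prod (Module.finBasis F[T;T⁻¹] (LinearMap.ker f))).map (LinearEquiv.ofBijective g hg)
  have hb1 : ∀ i, b (.inl i) = s (c i) := fun i => by simp [b, g]
  have hb2 : ∀ i, A *ᵥ b (.inr i) = 0 := fun i => by simp [b, g, hker]
  have hr : ∀ v i, matrixForm A v (b (.inr i)) = 0 := fun v i => by
    rw [matrixForm_apply, hb2, dotProduct_zero]
  have hl : ∀ v i, matrixForm A (b (.inr i)) v = 0 := fun v i => by
    rw [← neg_eq_zero, ← invert_matrixForm hA, hr, map_zero]
  refine ⟨_, _, Matrix.of fun i j => matrixForm A (b (.inl i)) (b (.inl j)), ?_,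
    congruent_of_basis A b ?_⟩
  -- A null vector of the block gives $w$ in the complement orthogonal to everything, so $Aw=0$; but
  -- $A$ is injective on the complement.
  · intro hdet
    obtain ⟨a, ha, ha'⟩ := Matrix.exists_mulVec_eq_zero_iff.2 hdet
    apply ha
    let w := ∑ j, a j • b (.inl j)
    have h1 : ∀ i, matrixForm A (b i) w = 0 := by
      rintro (i | i)
      · have := congrFun ha' i
        simpa [w, mulVec, dotProduct, mul_comm] using this
      · exact hl _ i
    have h2 : ∀ v, matrixForm A v w = 0 := by
      intro v
      rw [← b.sum_repr v, map_sum (matrixForm A), LinearMap.sum_apply]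
      exact Finset.sum_eq_zero fun i _ => by rw [LinearMap.map_smulₛₗ₂, h1, smul_zero]
    have h3 : A *ᵥ w = 0 := by
      ext1 i
      have := h2 (fun k => invert ((Pi.single i 1 : ι → F[T;T⁻¹]) k))
      rw [matrixForm_apply] at this
      simpa using this
    have h4 : ∑ j, a j • c j = 0 := by
      apply Subtype.ext
      rw [← hs', map_sum]
      simpa [w, hb1] using h3
    ext1 j
    exact Fintype.linearIndependent_iff.1 c.linearIndependent a h4 j
  · rintro (i | i) (j | j)
    · rfl
    · exact hr _ j
    · exact hl _ i
    · exact hr _ j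

/-- The decomposition of an elementary form, in terms of matrices. -/
theorem exists_congruent_normalForm_of_isElementary [Finite F] [DecidableEq ι]
    {A : Matrix ι ι F[T;T⁻¹]} (hA : IsAlt (matrixForm A)) (hA' : IsElementary (matrixForm A))
    (z : ℕ) : ∃ s t : ℕ, Congruent (fromBlocks A 0 0 (0 : Matrix (Fin z) (Fin z) F[T;T⁻¹]))
      (normalForm F s t z) := by
  classical
  obtain ⟨τ, _, d, b, hd, hb, hb'⟩ := hA'.exists_decomposition hA
  have h1 : Congruent A
      (Matrix.of fun x y => matrixForm A (b x) (b y) : Matrix (τ × Fin 2) (τ × Fin 2) _) :=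
    congruent_of_basis A b fun _ _ => rfl
  -- Sort the planes into copies of $\xi$ ($d\ne1$) and of $\lambda_1$ ($d=1$).
  let e₁ : Fin (Fintype.card {x // d x ≠ 1}) ≃ {x // d x ≠ 1} := (Fintype.equivFin _).symm
  let e₀ : Fin (Fintype.card {x // ¬d x ≠ 1}) ≃ {x // ¬d x ≠ 1} := (Fintype.equivFin _).symm
  have he₁ : ∀ a, planeGram (d (e₁ a)) = xi F := fun a => by
    rw [(hd (e₁ a)).resolve_left (e₁ a).2, planeGram_T_one_sub_one]
  have he₀ : ∀ a, planeGram (d (e₀ a)) = lambdaOne F := fun a => by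
    rw [not_not.1 (e₀ a).2, planeGram_one]
  have hne : ∀ a a', (e₁ a : τ) ≠ e₀ a' := fun a a' h => (e₀ a').2 (h ▸ (e₁ a).2)
  let e := (Equiv.sumAssoc _ _ _).symm.trans
    (Equiv.sumCongr ((Equiv.prodSumDistrib (Fin 2) _ _).symm.trans
    ((Equiv.prodComm _ _).trans (Equiv.prodCongr ((Equiv.sumCongr e₁ e₀).trans
      (Equiv.sumCompl (fun x => d x ≠ 1))) (Equiv.refl _)))) (Equiv.refl (Fin z)))
  refine ⟨_, _, h1.fromBlocks_zero.trans (congruent_of_equiv e ?_)⟩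
  have E1 : ∀ i a, e (.inl (i, a)) = .inl ((e₁ a : τ), i) := fun i a => rfl
  have E2 : ∀ i a, e (.inr (.inl (i, a))) = .inl ((e₀ a : τ), i) := fun i a => rfl
  have E3 : ∀ a, e (.inr (.inr a)) = .inr a := fun a => rfl
  rintro (⟨i, a⟩ | ⟨i, a⟩ | a) (⟨j, a'⟩ | ⟨j, a'⟩ | a') <;>
    simp only [E1, E2, E3, normalForm, fromBlocks_apply₁₁, fromBlocks_apply₁₂, fromBlocks_apply₂₁,
      fromBlocks_apply₂₂, Matrix.zero_apply, of_apply, blockDiagonal_apply]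
  · split_ifs with h
    · rw [h, hb, he₁]
    · exact hb' _ _ _ _ fun h' => h (e₁.injective (Subtype.ext h'))
  · exact hb' _ _ _ _ (hne _ _)
  · exact hb' _ _ _ _ (hne _ _).symm
  · split_ifs with h
    · rw [h, hb, he₀]
    · exact hb' _ _ _ _ fun h' => h (e₀.injective (Subtype.ext h'))

theorem congruent_coarsen_fromBlocks {m z : ℕ} (b : ℕ+) (B : Matrix (Fin m) (Fin m) F[T;T⁻¹]) :
    Congruent (coarsen b (fromBlocks B 0 0 (0 : Matrix (Fin z) (Fin z) F[T;T⁻¹])))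
      (fromBlocks (coarsen b B) 0 0 (0 : Matrix (Fin (z * b)) (Fin (z * b)) F[T;T⁻¹])) := by
  refine congruent_of_equiv ((Equiv.sumCongr (Equiv.refl _) finProdFinEquiv.symm).trans
    (Equiv.sumProdDistrib (Fin m) (Fin z) (Fin b)).symm) ?_
  rintro (i | i) (j | j) <;> ext k <;> simp [coeff_coarsen]

theorem IsAntiHermitian.of_congruent [DecidableEq ι] [DecidableEq κ] {A : Matrix ι ι F[T;T⁻¹]}
    {B : Matrix κ κ F[T;T⁻¹]} (hA : IsAntiHermitian A) (h : Congruent A B) :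
    IsAntiHermitian B := by
  obtain ⟨E, -, -, -, rfl⟩ := h
  have h1 : dagger (dagger E) = E := by
    ext1 i j
    simp [dagger_apply]
  rw [IsAntiHermitian, dagger_mul, dagger_mul, hA, h1]
  simp [Matrix.mul_assoc]

theorem DiagZeroConst.of_congruent [DecidableEq ι] [DecidableEq κ] {A : Matrix ι ι F[T;T⁻¹]}
    {B : Matrix κ κ F[T;T⁻¹]} (hA : IsAntiHermitian A) (hA₀ : DiagZeroConst A)
    (h : Congruent A B) : DiagZeroConst B := by
  obtain ⟨E, -, -, -, rfl⟩ := h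
  intro i
  have h1 : (dagger E * A * E) i i = matrixForm A (fun j => E j i) (fun j => E j i) := by
    rw [Matrix.mul_assoc, matrixForm_apply]
    rfl
  rw [h1]
  exact (isAlt_matrixForm hA hA₀).coeff_zero _

theorem exists_congruent_normalForm [Finite F] [DecidableEq ι] {A : Matrix ι ι F[T;T⁻¹]}
    (hA : IsAntiHermitian A) (hA₀ : DiagZeroConst A) :
    ∃ (s : ℕ) (b : ℕ+) (t z : ℕ), Congruent (coarsen b A) (normalForm F s t z) := by
  obtain ⟨m, z, B, hdet, hAB⟩ := exists_congruent_fromBlocks hA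
  have hB : IsAntiHermitian B := by
    have h1 := hA.of_congruent hAB
    ext1 i j
    exact congrFun (congrFun h1 (.inl i)) (.inl j)
  have hB₀ : DiagZeroConst B := fun i => hA₀.of_congruent hA hAB (.inl i)
  -- With $x^b-1=q\det B$, the matrix $q\,\mathrm{adj}(B)$ inverts $B$ up to $x^b-1$.
  obtain ⟨b, q, hq⟩ := exists_dvd_T_sub_one hdet
  have hG : (q • B.adjugate) * B = (T (b * 1) : F[T;T⁻¹]) • 1 - 1 := by
    rw [smul_mul_assoc, adjugate_mul, smul_smul, mul_comm, ← hq, sub_smul, one_smul, mul_one]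
  have hG' : coarsen b (q • B.adjugate) * coarsen b B = (T 1 - 1 : F[T;T⁻¹]) • 1 := by
    rw [← coarsen_mul, hG, coarsen_sub, coarsen_scalar, coarsen_one, sub_smul, one_smul]
  obtain ⟨s, t, h⟩ := exists_congruent_normalForm_of_isElementary
    (isAlt_matrixForm (hB.coarsen b) (hB₀.coarsen b)) (isElementary_matrixForm hG') (z * b)
  exact ⟨s, b, t, z * b, (hAB.coarsen b).trans ((congruent_coarsen_fromBlocks b B).trans h)⟩

end MatrixForm

end LaurentForm

theorem mainTheorem11 (p : ℕ) [Fact p.Prime] {ι : Type*} [Fintype ι] [DecidableEq ι]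
    (Ξ : Matrix ι ι (LaurentPolynomial (ZMod p)))
    (hΞ : LaurentForm.IsAntiHermitian Ξ)
    (hdiag : p = 2 → LaurentForm.DiagZeroConst Ξ) :
    ∃ s : ℕ,
      (∃ (b : ℕ+) (t z : ℕ),
        LaurentForm.Congruent (LaurentForm.coarsen b Ξ)
          (LaurentForm.normalForm (ZMod p) s t z)) ∧
      ∀ (b : ℕ+) (s' t z : ℕ),
        LaurentForm.Congruent (LaurentForm.coarsen b Ξ)
          (LaurentForm.normalForm (ZMod p) s' t z) → s' = s := by
  have h0 : LaurentForm.DiagZeroConst Ξ := by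
    rcases eq_or_ne p 2 with h2 | h2
    · exact hdiag h2
    · intro i
      -- The constant term equals its own negative, hence is 0 for odd $p$.
      have h1 := congrArg (fun f => f.coeff 0) (congrFun (congrFun hΞ i) i)
      simp only [LaurentForm.dagger_apply, LaurentForm.coeff_invert, neg_zero, Matrix.neg_apply,
        AddMonoidAlgebra.coeff_neg, Finsupp.neg_apply] at h1
      refine ((ZMod.neg_eq_self_iff _).1 h1.symm).resolve_right fun h => ?_
      rcases (Fact.out : p.Prime).eq_one_or_self_of_dvd 2 ⟨_, h.symm⟩ with h3 | h3
      · omega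
      · exact h2 h3.symm
  obtain ⟨s, b, t, z, h⟩ := LaurentForm.exists_congruent_normalForm hΞ h0
  refine ⟨s, ⟨b, t, z, h⟩, fun b' s' t' z' h' => ?_⟩
  -- Both normal forms have the torsion count of $\Xi$, so $p^{2s'}=p^{2s}$.
  have h1 := h.torsionCard_eq
  have h2 := h'.torsionCard_eq
  rw [LaurentForm.torsionCard_coarsen, LaurentForm.torsionCard_normalForm] at h1 h2
  have h3 := h2.trans h1.symm
  rw [Nat.card_zmod] at h3
  have := Nat.pow_right_injective (Fact.out : p.Prime).two_le h3
  simpa using this
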